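/- Theorem 9.12 (7.12). Let $\mathbb G_2=\{(z_1+z_2,z_1z_2):|z_1|<1,|z_2|<1\}\subset\mathbb C^2$ and $\Gamma=\overline{\mathbb G}_2$, let $\partial\Gamma$ be the topological boundary of $\Gamma$, and let $b\Gamma$ be its distinguished boundary, i.e. the smallest closed subset of $\Gamma$ on which every rational function with no poles in $\Gamma$ attains its maximum modulus over $\Gamma$. A polynomial $q\in\mathbb C[z_1,z_2]$ with zero set $Z(q)$ is called $\Gamma$-distinguished if $Z(q)\cap\mathbb G_2\neq\emptyset$ and $Z(q)\cap\partial\Gamma=Z(q)\cap b\Gamma$. A commuting pair $(S,P)$ of bounded operators on a complex Hilbert space is a $\Gamma$-contraction if $\Gamma$ is a spectral set for it, i.e. its Taylor joint spectrum lies in $\Gamma$ and $\|f(S,P)\|\le\sup_\Gamma|f|$ for every rational function $f=p/q$ with $p,q\in\mathbb C[z_1,z_2]$ and $q$ zero-free on $\Gamma$. A $\Gamma$-contraction $(S,P)$ is called $\Gamma$-distinguished if $q(S,P)=0$ for some $\Gamma$-distinguished polynomial $q$. Let $(S,P)$ be a $\Gamma$-distinguished $\Gamma$-contraction on a complex Hilbert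 space $\mathcal H$. Put $D_P=(I-P^*P)^{1/2}$ and $\mathcal D_P=\overline{\operatorname{Ran}}\,D_P$, and let $A\in\mathcal B(\mathcal D_P)$ be the fundamental operator of $(S,P)$, i.e. the unique solution of $S-S^*P=D_PAD_P$. Let $T_A,V_0$ be the operators on $\mathcal H\oplus\ell^2(\mathcal D_P)$ given by $$T_A(x_0,x_1,x_2,\dots)=(Sx_0,\ A^*D_Px_0+Ax_1,\ A^*x_1+Ax_2,\ A^*x_2+Ax_3,\dots),$$ $$V_0(x_0,x_1,x_2,\dots)=(Px_0,\ D_Px_0,\ x_1,\ x_2,\dots).$$ If $A$ is hyponormal, i.e. $A^*A-AA^*\ge 0$, then $(T_A,V_0)$ is $\Gamma$-distinguished if and only if $(A,0)$, a pair of operators on $\mathcal D_P$, is $\Gamma$-distinguished. -/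

import Mathlib

noncomputable section

namespace SymBidisc

/-! ### The symmetrized bidisc, distinguished boundaries and distinguished polynomials -/

/-- The open symmetrized bidisc `{(z₁ + z₂, z₁ z₂) : |z₁| < 1, |z₂| < 1}` in `ℂ²`. -/
def G2 : Set (ℂ × ℂ) :=
  {x | ∃ z₁ z₂ : ℂ, ‖z₁‖ < 1 ∧ ‖z₂‖ < 1 ∧ x = (z₁ + z₂, z₁ * z₂)}

/-- The closed symmetrized bidisc `Γ`, the closure of `G2`. -/
def Gam : Set (ℂ × ℂ) := closure G2

/-- The value of a polynomial in two variables at a point of `ℂ²`. -/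
def evalPt (p : MvPolynomial (Fin 2) ℂ) (x : ℂ × ℂ) : ℂ :=
  MvPolynomial.eval ![x.1, x.2] p

/-- The zero set `Z(p)` in `ℂ²`. -/
def zeroSet (p : MvPolynomial (Fin 2) ℂ) : Set (ℂ × ℂ) := {x | evalPt p x = 0}

/-- `C` is a boundary for `X`: a closed subset of `X` on which every rational function `p / q`
with `q` zero-free on `X` attains its maximum modulus over `X`. -/
def IsBoundaryFor (X C : Set (ℂ × ℂ)) : Prop :=
  C ⊆ X ∧ IsClosed C ∧
    ∀ p q : MvPolynomial (Fin 2) ℂ, (∀ x ∈ X, evalPt q x ≠ 0) →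
      ∃ c ∈ C, ∀ x ∈ X, ‖evalPt p x / evalPt q x‖ ≤ ‖evalPt p c / evalPt q c‖

/-- The distinguished boundary `bX` of a compact set `X`: the intersection of all boundaries. -/
def distBoundary (X : Set (ℂ × ℂ)) : Set (ℂ × ℂ) := ⋂₀ {C | IsBoundaryFor X C}

/-- A polynomial `p` is `Γ`-distinguished if its zero set meets the open symmetrized bidisc and
`Z(p) ∩ ∂Γ = Z(p) ∩ bΓ`. -/
def IsGammaDistinguishedPoly (p : MvPolynomial (Fin 2) ℂ) : Prop :=
  (zeroSet p ∩ G2).Nonempty ∧ zeroSet p ∩ frontier Gam = zeroSet p ∩ distBoundary Gam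

/-! ### Pairs of operators -/

section Operators

variable {H : Type*} [NormedAddCommGroup H] [InnerProductSpace ℂ H]

/-- `p(S, P) = ∑ c_{ij} S^i P^j` for a polynomial `p = ∑ c_{ij} z₁^i z₂^j`. -/
def polyOp (p : MvPolynomial (Fin 2) ℂ) (S P : H →L[ℂ] H) : H →L[ℂ] H :=
  ∑ m ∈ p.support, p.coeff m • (S ^ m 0 * P ^ m 1)

/-- Exactness of the Koszul complex
`0 → H → H ⊕ H → H → 0`, `x ↦ (M x, N x)`, `(x, y) ↦ M y - N x`,
of a pair `(M, N)` of operators. -/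
def KoszulExact (M N : H →L[ℂ] H) : Prop :=
  (∀ x, M x = 0 → N x = 0 → x = 0) ∧
  (∀ x y, M y - N x = 0 → ∃ z, x = M z ∧ y = N z) ∧
  (∀ w, ∃ x y, M y - N x = w)

/-- The Taylor joint spectrum of a commuting pair of operators. -/
def taylorSpectrum (S P : H →L[ℂ] H) : Set (ℂ × ℂ) :=
  {z | ¬ KoszulExact (S - z.1 • (1 : H →L[ℂ] H)) (P - z.2 • (1 : H →L[ℂ] H))}

/-- The compact set `X` is a spectral set for the commuting pair `(S, P)`: it contains the Taylor
joint spectrum, and `‖f(S, P)‖ ≤ sup_X |f|` for every rational function `f = p / q` with `q`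
zero-free on `X`. Here `f(S, P) = p(S, P) R`, where `R` is the inverse of `q(S, P)`; this inverse
exists because `q` has no zero on the Taylor joint spectrum. -/
def IsSpectralSet (X : Set (ℂ × ℂ)) (S P : H →L[ℂ] H) : Prop :=
  taylorSpectrum S P ⊆ X ∧
    ∀ p q : MvPolynomial (Fin 2) ℂ, (∀ x ∈ X, evalPt q x ≠ 0) →
      ∀ R : H →L[ℂ] H, R * polyOp q S P = 1 → polyOp q S P * R = 1 →
        ‖polyOp p S P * R‖ ≤ sSup ((fun x => ‖evalPt p x / evalPt q x‖) '' X)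

/-- A `Γ`-contraction: a commuting pair of operators for which `Γ` is a spectral set. -/
def IsGammaContraction (S P : H →L[ℂ] H) : Prop :=
  Commute S P ∧ IsSpectralSet Gam S P

/-- A `Γ`-distinguished pair: a `Γ`-contraction that is annihilated by a `Γ`-distinguished
polynomial. -/
def IsGammaDistinguished (S P : H →L[ℂ] H) : Prop :=
  IsGammaContraction S P ∧ ∃ q, IsGammaDistinguishedPoly q ∧ polyOp q S P = 0

end Operators

section Defect

variable {H : Type*} [NormedAddCommGroup H] [InnerProductSpace ℂ H] [CompleteSpace H]

/-- An operator `T` is hyponormal if `T* T - T T* ≥ 0`. -/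
def IsHyponormal (T : H →L[ℂ] H) : Prop := (star T * T - T * star T).IsPositive

/-- The defect operator `D_P = (1 - P* P)^{1/2}` of a contraction `P`. -/
def defectOp (P : H →L[ℂ] H) : H →L[ℂ] H := CFC.sqrt (1 - star P * P)

/-- The defect space `𝒟_P`, the closure of the range of `D_P`. -/
abbrev defectSpace (P : H →L[ℂ] H) : Submodule ℂ H :=
  (defectOp P).range.topologicalClosure

/-- `D_P` as an operator from `H` to the defect space. -/
def defectMap (P : H →L[ℂ] H) : H →L[ℂ] defectSpace P :=
  (defectOp P).codRestrict (defectSpace P)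
    fun x => Submodule.le_topologicalClosure _ (LinearMap.mem_range_self _ x)

/-- `A ∈ B(𝒟_P)` is the fundamental operator of `(S, P)`: it solves `S - S* P = D_P A D_P`.
A solution is unique since the range of `D_P` is dense in `𝒟_P`. -/
def IsFundamentalOperator (S P : H →L[ℂ] H) (A : defectSpace P →L[ℂ] defectSpace P) : Prop :=
  S - star S * P = (defectOp P ∘L (defectSpace P).subtypeL) ∘L A ∘L defectMap P

end Defect

/-! ### Operators on `ℓ²(E)` -/

section Ell2

/-- `ℓ²(E)`: square-summable sequences in `E` indexed by `ℕ`. -/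
abbrev ell2 (E : Type*) [NormedAddCommGroup E] := lp (fun _ : ℕ => E) 2

variable {E : Type*} [NormedAddCommGroup E]

lemma ell2_summable (x : ell2 E) : Summable fun n => ‖x n‖ ^ 2 := by
  have h := (memℓp_gen_iff (p := 2) (by norm_num)).1 (lp.memℓp x)
  simpa using h

lemma ell2_norm_sq (x : ell2 E) : ‖x‖ ^ 2 = ∑' n, ‖x n‖ ^ 2 := by
  have h := lp.norm_rpow_eq_tsum (p := 2) (by norm_num) x
  simpa using h

lemma ell2_mem {f : ℕ → E} (h : Summable fun n => ‖f n‖ ^ 2) :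
    Memℓp (E := fun _ : ℕ => E) f 2 := by
  refine (memℓp_gen_iff (p := 2) (by norm_num)).2 ?_
  simpa using h

/-- The sequence `(0, x₀, x₁, …)`. -/
def shiftSeq (x : ℕ → E) : ℕ → E
  | 0 => 0
  | n + 1 => x n

lemma summable_shift (x : ell2 E) : Summable fun n => ‖shiftSeq (x : ℕ → E) n‖ ^ 2 :=
  (summable_nat_add_iff 1).1 (ell2_summable x)

variable [InnerProductSpace ℂ E]

lemma summable_diag (T : E →L[ℂ] E) (x : ell2 E) : Summable fun n => ‖T (x n)‖ ^ 2 := by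
  refine Summable.of_nonneg_of_le (fun n => by positivity) (fun n => ?_)
    ((ell2_summable x).mul_left (‖T‖ ^ 2))
  rw [← mul_pow]
  gcongr
  exact T.le_opNorm _

/-- The diagonal operator `(x₀, x₁, …) ↦ (T x₀, T x₁, …)` on `ℓ²(E)`. -/
def diagOp (T : E →L[ℂ] E) : ell2 E →L[ℂ] ell2 E :=
  LinearMap.mkContinuous
    { toFun := fun x => ⟨fun n => T (x n), ell2_mem (summable_diag T x)⟩
      map_add' := fun x y => by ext n; exact T.map_add _ _
      map_smul' := fun c x => by ext n; exact T.map_smul _ _ } ‖T‖ (by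
    intro x
    refine le_of_sq_le_sq ?_ (by positivity)
    rw [mul_pow, ell2_norm_sq, ell2_norm_sq, ← tsum_mul_left]
    refine (summable_diag T x).tsum_le_tsum (fun n => ?_) ((ell2_summable x).mul_left _)
    rw [← mul_pow]
    gcongr
    exact T.le_opNorm _)

/-- The unilateral shift `(x₀, x₁, …) ↦ (0, x₀, x₁, …)` on `ℓ²(E)`. -/
def shiftOp : ell2 E →L[ℂ] ell2 E :=
  LinearMap.mkContinuous
    { toFun := fun x => ⟨shiftSeq (x : ℕ → E), ell2_mem (summable_shift x)⟩
      map_add' := fun x y => by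
        ext n
        cases n
        · exact (add_zero (0 : E)).symm
        · rfl
      map_smul' := fun c x => by
        ext n
        cases n
        · exact (smul_zero c).symm
        · rfl } 1 (by
    intro x
    refine le_of_sq_le_sq ?_ (by positivity)
    rw [one_mul, ell2_norm_sq, ell2_norm_sq]
    refine ((summable_shift x).tsum_eq_zero_add).trans_le ?_
    simp [shiftSeq])

/-- The embedding `x ↦ (x, 0, 0, …)` of `E` into `ℓ²(E)`. -/
def headOp : E →L[ℂ] ell2 E :=
  lp.singleContinuousLinearMap ℂ (fun _ : ℕ => E) 2 0

lemma diagOp_apply (T : E →L[ℂ] E) (x : ell2 E) (n : ℕ) : diagOp T x n = T (x n) := rfl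

lemma shiftOp_zero (x : ell2 E) : shiftOp x 0 = 0 := rfl

lemma shiftOp_succ (x : ell2 E) (n : ℕ) : shiftOp x (n + 1) = x n := rfl

lemma headOp_zero (x : E) : headOp x 0 = x :=
  lp.single_apply_self (E := fun _ : ℕ => E) 2 0 x

lemma headOp_succ (x : E) (n : ℕ) : headOp x (n + 1) = 0 :=
  lp.single_apply_ne (E := fun _ : ℕ => E) 2 0 x (Nat.succ_ne_zero n)

end Ell2

/-! ### The dilation -/

section Dilation

variable {H : Type*} [NormedAddCommGroup H] [InnerProductSpace ℂ H] [CompleteSpace H]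

/-- The Hilbert space `H ⊕ ℓ²(𝒟_P)`. -/
abbrev dilSpace (P : H →L[ℂ] H) := WithLp 2 (H × ell2 (defectSpace P))

/-- The operator with block matrix `[[X, 0], [Y, Z]]` on `H ⊕ ℓ²(𝒟_P)`. -/
def blockOp (P X : H →L[ℂ] H) (Y : H →L[ℂ] ell2 (defectSpace P))
    (Z : ell2 (defectSpace P) →L[ℂ] ell2 (defectSpace P)) : dilSpace P →L[ℂ] dilSpace P :=
  ((WithLp.prodContinuousLinearEquiv 2 ℂ H (ell2 (defectSpace P))).symm :
      H × ell2 (defectSpace P) →L[ℂ] dilSpace P) ∘L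
    ((X ∘L ContinuousLinearMap.fst ℂ H (ell2 (defectSpace P))).prod (Y.coprod Z)) ∘L
    ((WithLp.prodContinuousLinearEquiv 2 ℂ H (ell2 (defectSpace P))) :
      dilSpace P →L[ℂ] H × ell2 (defectSpace P))

/-- `T_A (x₀, x₁, x₂, …) = (S x₀, A* D_P x₀ + A x₁, A* x₁ + A x₂, A* x₂ + A x₃, …)`. -/
def dilT (S P : H →L[ℂ] H) (A : defectSpace P →L[ℂ] defectSpace P) :
    dilSpace P →L[ℂ] dilSpace P :=
  blockOp P S (headOp ∘L star A ∘L defectMap P) (diagOp A + shiftOp ∘L diagOp (star A))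

/-- `V₀ (x₀, x₁, x₂, …) = (P x₀, D_P x₀, x₁, x₂, …)`. -/
def dilV (P : H →L[ℂ] H) : dilSpace P →L[ℂ] dilSpace P :=
  blockOp P P (headOp ∘L defectMap P) shiftOp

lemma dilT_fst (S P : H →L[ℂ] H) (A : defectSpace P →L[ℂ] defectSpace P) (x : dilSpace P) :
    (dilT S P A x).fst = S x.fst := rfl

lemma dilT_snd (S P : H →L[ℂ] H) (A : defectSpace P →L[ℂ] defectSpace P) (x : dilSpace P)
    (n : ℕ) :
    (dilT S P A x).snd n = headOp (star A (defectMap P x.fst)) n +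
      (diagOp A x.snd n + shiftOp (diagOp (star A) x.snd) n) := rfl

lemma dilT_snd_zero (S P : H →L[ℂ] H) (A : defectSpace P →L[ℂ] defectSpace P)
    (x : dilSpace P) :
    (dilT S P A x).snd 0 = star A (defectMap P x.fst) + A (x.snd 0) := by
  rw [dilT_snd, headOp_zero, shiftOp_zero, diagOp_apply, add_zero]

lemma dilT_snd_succ (S P : H →L[ℂ] H) (A : defectSpace P →L[ℂ] defectSpace P)
    (x : dilSpace P) (n : ℕ) :
    (dilT S P A x).snd (n + 1) = star A (x.snd n) + A (x.snd (n + 1)) := by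
  rw [dilT_snd, headOp_succ, shiftOp_succ, diagOp_apply, diagOp_apply, zero_add]
  exact add_comm _ _

lemma dilV_fst (P : H →L[ℂ] H) (x : dilSpace P) : (dilV P x).fst = P x.fst := rfl

lemma dilV_snd (P : H →L[ℂ] H) (x : dilSpace P) (n : ℕ) :
    (dilV P x).snd n = headOp (defectMap P x.fst) n + shiftOp x.snd n := rfl

lemma dilV_snd_zero (P : H →L[ℂ] H) (x : dilSpace P) :
    (dilV P x).snd 0 = defectMap P x.fst := by
  rw [dilV_snd, headOp_zero, shiftOp_zero, add_zero]

lemma dilV_snd_succ (P : H →L[ℂ] H) (x : dilSpace P) (n : ℕ) :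
    (dilV P x).snd (n + 1) = x.snd n := by
  rw [dilV_snd, headOp_succ, shiftOp_succ, zero_add]

end Dilation

end SymBidisc

end

noncomputable section

namespace SymBidisc

open Filter Topology

/-! The pair `(T_A, V₀)` is block lower triangular: `(S, P)` sits on `H`, and on the invariant
subspace `ℓ²(𝒟_P)` it is the Toeplitz pair with symbols `A + z A*` and `z`. The map `y ↦ y 0`
intertwines the Toeplitz pair with `(A, 0)`. Hence `‖p(A, 0)‖ ≤ ‖p(T_A, V₀)‖` for every polynomial
`p`, and both the von Neumann inequality and the annihilating polynomial descend to `(A, 0)`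
(`IsGammaDistinguished.of_dilation`).

Conversely, let `q₂(A, 0) = 0`. The polynomial `q₂(·, 0)` annihilates `A` and has no zero on the
unit circle, because `(λ, 0)` with `|λ| = 1` lies in `∂Γ` but not in `bΓ`. A hyponormal operator
annihilated by a nonzero polynomial is normal (`IsHyponormal.selfCommutator_eq_zero_of_aeval`), so
the spectral condition gives `‖A‖ ≤ 1`. Factors with roots outside the closed disc are then
invertible at `A`, which leaves `∏ (A - λᵢ) = 0` with `|λᵢ| < 1`. Put `r = ∏ (s - λᵢ - λ̄ᵢ p)`. Each
factor has Toeplitz symbol `(A - λᵢ) + z (A - λᵢ)*`, and normality makes `r` annihilate the Toeplitz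
pair. If `q₁(S, P) = 0`, then `q₁(T_A, V₀)` maps into `ℓ²(𝒟_P)`, so `r q₁` annihilates the dilation;
it is `Γ`-distinguished because the factors of `r` vanish on `∂Γ` only at points of `bΓ`.

It remains that `(T_A, V₀)` is a `Γ`-contraction (`isGammaContraction_dil`). Polynomial convexity of
`Γ` reduces this to polynomials (`isGammaContraction_iff`), and the discrete Fourier transform
settles the Toeplitz block. The isometry `V₀ⁿ` pushes a vector to where the coupling between the two
blocks is negligible, since `D_P Pⁿ x → 0`. -/

/-! ### Geometry of the symmetrized bidisc -/

/-- The symmetrization map `(z, w) ↦ (z + w, z w)`. -/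
def symPt (z w : ℂ) : ℂ × ℂ := (z + w, z * w)

lemma continuous_symPt : Continuous fun x : ℂ × ℂ => symPt x.1 x.2 := by
  unfold symPt; fun_prop

lemma symPt_comm (z w : ℂ) : symPt z w = symPt w z := by
  simp [symPt, add_comm, mul_comm]

lemma symPt_eq_iff {z w a b : ℂ} :
    symPt z w = symPt a b ↔ (z = a ∧ w = b) ∨ (z = b ∧ w = a) := by
  constructor
  · intro h
    simp only [symPt, Prod.mk.injEq] at h
    obtain ⟨h1, h2⟩ := h
    have : (z - a) * (z - b) = 0 := by linear_combination z * h1 - h2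
    rcases mul_eq_zero.1 this with h | h
    · left
      have hz : z = a := sub_eq_zero.1 h
      exact ⟨hz, by linear_combination h1 - hz⟩
    · right
      have hz : z = b := sub_eq_zero.1 h
      exact ⟨hz, by linear_combination h1 - hz⟩
  · rintro (⟨rfl, rfl⟩ | ⟨rfl, rfl⟩)
    · rfl
    · exact symPt_comm _ _

lemma exists_symPt (x : ℂ × ℂ) : ∃ z w, x = symPt z w := by
  obtain ⟨d, hd⟩ := IsAlgClosed.exists_pow_nat_eq (x.1 ^ 2 - 4 * x.2) (n := 2) (by norm_num)
  refine ⟨(x.1 + d) / 2, (x.1 - d) / 2, Prod.ext ?_ ?_⟩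
  · simp only [symPt]; ring
  · simp only [symPt]; linear_combination (-1 / 4 : ℂ) * (-hd)

lemma symPt_mem_G2 {z w : ℂ} : symPt z w ∈ G2 ↔ ‖z‖ < 1 ∧ ‖w‖ < 1 := by
  constructor
  · rintro ⟨a, b, ha, hb, h⟩
    rcases symPt_eq_iff.1 (h : symPt z w = symPt a b) with ⟨rfl, rfl⟩ | ⟨rfl, rfl⟩
    · exact ⟨ha, hb⟩
    · exact ⟨hb, ha⟩
  · rintro ⟨hz, hw⟩
    exact ⟨z, w, hz, hw, rfl⟩

/-- The closed bidisc. -/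
def bidisc : Set (ℂ × ℂ) := Metric.closedBall 0 1 ×ˢ Metric.closedBall 0 1

lemma mem_bidisc {x : ℂ × ℂ} : x ∈ bidisc ↔ ‖x.1‖ ≤ 1 ∧ ‖x.2‖ ≤ 1 := by
  simp [bidisc]

lemma isCompact_bidisc : IsCompact bidisc :=
  (isCompact_closedBall 0 1).prod (isCompact_closedBall 0 1)

lemma Gam_eq_image : Gam = (fun x : ℂ × ℂ => symPt x.1 x.2) '' bidisc := by
  apply subset_antisymm
  · refine closure_minimal ?_ (isCompact_bidisc.image continuous_symPt).isClosed
    rintro x ⟨z, w, hz, hw, rfl⟩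
    exact ⟨(z, w), mem_bidisc.2 ⟨hz.le, hw.le⟩, rfl⟩
  · have h : bidisc = closure (Metric.ball (0 : ℂ) 1 ×ˢ Metric.ball (0 : ℂ) 1) := by
      rw [closure_prod_eq, closure_ball _ one_ne_zero, bidisc]
    rw [h]
    refine (image_closure_subset_closure_image continuous_symPt).trans (closure_mono ?_)
    rintro _ ⟨⟨z, w⟩, ⟨hz, hw⟩, rfl⟩
    exact symPt_mem_G2.2 ⟨by simpa using hz, by simpa using hw⟩

lemma isCompact_Gam : IsCompact Gam := by
  rw [Gam_eq_image]; exact isCompact_bidisc.image continuous_symPt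

lemma symPt_mem_Gam {z w : ℂ} : symPt z w ∈ Gam ↔ ‖z‖ ≤ 1 ∧ ‖w‖ ≤ 1 := by
  rw [Gam_eq_image]
  constructor
  · rintro ⟨⟨a, b⟩, hab, h⟩
    rw [mem_bidisc] at hab
    rcases symPt_eq_iff.1 h with ⟨rfl, rfl⟩ | ⟨rfl, rfl⟩
    · exact hab
    · exact hab.symm
  · intro h
    exact ⟨(z, w), mem_bidisc.2 h, rfl⟩

lemma Gam_nonempty : Gam.Nonempty := ⟨symPt 0 0, symPt_mem_Gam.2 (by simp)⟩

lemma isClosed_Gam : IsClosed Gam := isClosed_closure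

/-- For `x = (z + w, z w)` the expression factors as `(1 - z u)(1 - w u)`. This criterion does not
mention the roots, so openness of `G2` follows from compactness of the disc. -/
lemma mem_G2_iff_forall {x : ℂ × ℂ} :
    x ∈ G2 ↔ ∀ u ∈ Metric.closedBall (0 : ℂ) 1, 1 - x.1 * u + x.2 * u ^ 2 ≠ 0 := by
  obtain ⟨z, w, rfl⟩ := exists_symPt x
  have hf : ∀ u, 1 - (symPt z w).1 * u + (symPt z w).2 * u ^ 2 = (1 - z * u) * (1 - w * u) := by
    intro u; simp only [symPt]; ring
  have key : ∀ v : ℂ, (∀ u ∈ Metric.closedBall (0 : ℂ) 1, 1 - v * u ≠ 0) ↔ ‖v‖ < 1 := by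
    intro v
    constructor
    · intro h
      by_contra! hv
      have hv0 : v ≠ 0 := by rintro rfl; simp at hv; linarith
      refine h v⁻¹ ?_ (by rw [mul_inv_cancel₀ hv0, sub_self])
      rw [mem_closedBall_zero_iff, norm_inv]
      exact inv_le_one_of_one_le₀ hv
    · intro hv u hu h
      rw [mem_closedBall_zero_iff] at hu
      have : ‖v * u‖ = 1 := by rw [← sub_eq_zero.1 h, norm_one]
      rw [norm_mul] at this
      nlinarith [norm_nonneg v, norm_nonneg u]
  rw [symPt_mem_G2, ← key, ← key]
  simp only [hf, mul_ne_zero_iff]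
  exact ⟨fun h u hu => ⟨h.1 u hu, h.2 u hu⟩, fun h => ⟨fun u hu => (h u hu).1, fun u hu => (h u hu).2⟩⟩

lemma isOpen_G2 : IsOpen G2 := by
  rw [isOpen_iff_eventually]
  intro x hx
  have : ∀ᶠ y in 𝓝 x, ∀ u ∈ Metric.closedBall (0 : ℂ) 1, 1 - y.1 * u + y.2 * u ^ 2 ≠ 0 := by
    refine (isCompact_closedBall (0 : ℂ) 1).eventually_forall_of_forall_eventually fun u hu => ?_
    have hc : Continuous fun q : (ℂ × ℂ) × ℂ => 1 - q.1.1 * q.2 + q.1.2 * q.2 ^ 2 := by fun_prop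
    exact hc.continuousAt.eventually_ne (mem_G2_iff_forall.1 hx u hu)
  filter_upwards [this] with y hy
  exact mem_G2_iff_forall.2 hy

/-- The points `(r z, r w)` with `r` slightly above `1` leave the bidisc, so no neighbourhood fits
inside `Γ`. -/
lemma symPt_mem_frontier {z w : ℂ} (hz : ‖z‖ = 1) (hw : ‖w‖ ≤ 1) : symPt z w ∈ frontier Gam := by
  rw [isClosed_Gam.frontier_eq]
  refine ⟨symPt_mem_Gam.2 ⟨hz.le, hw⟩, fun hint => ?_⟩
  have hc : ContinuousAt (fun r : ℝ => symPt ((r : ℂ) * z) ((r : ℂ) * w)) 1 := by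
    unfold symPt; fun_prop
  have h1 : Gam ∈ 𝓝 (symPt (((1 : ℝ) : ℂ) * z) (((1 : ℝ) : ℂ) * w)) := by
    simpa using mem_interior_iff_mem_nhds.1 hint
  have h2 : ∀ᶠ r : ℝ in 𝓝[>] (1 : ℝ), symPt ((r : ℂ) * z) ((r : ℂ) * w) ∈ Gam :=
    nhdsWithin_le_nhds (hc h1)
  obtain ⟨r, hr, hr1⟩ := (h2.and self_mem_nhdsWithin).exists
  have := (symPt_mem_Gam.1 hr).1
  rw [norm_mul, hz, mul_one, Complex.norm_real, Real.norm_eq_abs] at this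
  exact absurd (le_of_abs_le this) (not_le.2 hr1)

lemma frontier_Gam_disjoint_G2 {x : ℂ × ℂ} (hx : x ∈ frontier Gam) : x ∉ G2 := by
  rw [isClosed_Gam.frontier_eq] at hx
  exact fun h => hx.2 (interior_maximal subset_closure isOpen_G2 h)

/-! ### Polynomials and evaluation -/

lemma evalPt_mul (p q : MvPolynomial (Fin 2) ℂ) (x : ℂ × ℂ) :
    evalPt (p * q) x = evalPt p x * evalPt q x := map_mul _ _ _

lemma continuous_evalPt (p : MvPolynomial (Fin 2) ℂ) : Continuous (evalPt p) := by
  unfold evalPt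
  exact (MvPolynomial.continuous_eval p).comp (by
    refine continuous_pi fun i => ?_
    fin_cases i
    · exact continuous_fst
    · exact continuous_snd)

/-! ### The distinguished boundary of `Γ` is the symmetrized torus. -/

/-- The image of the torus under the symmetrization map. -/
def symTorus : Set (ℂ × ℂ) := {x | ∃ z w : ℂ, ‖z‖ = 1 ∧ ‖w‖ = 1 ∧ x = symPt z w}

lemma symTorus_subset_frontier : symTorus ⊆ frontier Gam := by
  rintro _ ⟨z, w, hz, hw, rfl⟩
  exact symPt_mem_frontier hz hw.le

lemma isClosed_symTorus : IsClosed symTorus := by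
  have : symTorus = (fun x : ℂ × ℂ => symPt x.1 x.2) ''
      (Metric.sphere 0 1 ×ˢ Metric.sphere 0 1) := by
    ext x
    constructor
    · rintro ⟨z, w, hz, hw, rfl⟩
      exact ⟨(z, w), by simp [hz, hw], rfl⟩
    · rintro ⟨⟨z, w⟩, h, rfl⟩
      simp only [Set.mem_prod, mem_sphere_zero_iff_norm] at h
      exact ⟨z, w, h.1, h.2, rfl⟩
  rw [this]
  exact (((isCompact_sphere 0 1).prod (isCompact_sphere 0 1)).image continuous_symPt).isClosed

lemma differentiable_evalPt_symPt (p : MvPolynomial (Fin 2) ℂ) (w : ℂ) :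
    Differentiable ℂ fun z => evalPt p (symPt z w) := by
  induction p using MvPolynomial.induction_on with
  | C a => simp [evalPt]
  | add p q hp hq =>
    have : (fun z => evalPt (p + q) (symPt z w)) =
      fun z => evalPt p (symPt z w) + evalPt q (symPt z w) := by
        funext z; simp [evalPt]
    rw [this]; exact hp.add hq
  | mul_X p i hp =>
    have : (fun z => evalPt (p * MvPolynomial.X i) (symPt z w)) =
      fun z => evalPt p (symPt z w) * (![(symPt z w).1, (symPt z w).2] i) := by
        funext z; simp [evalPt]
    rw [this]
    refine hp.mul ?_
    fin_cases i <;> simp [symPt]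

/-- One-variable maximum principle in `z` with `w` frozen; using it once per variable moves a
maximum point to the torus. -/
lemma exists_norm_eq_one_le (p q : MvPolynomial (Fin 2) ℂ)
    (hq : ∀ x ∈ Gam, evalPt q x ≠ 0) {z w : ℂ} (hz : ‖z‖ ≤ 1) (hw : ‖w‖ ≤ 1) :
    ∃ u : ℂ, ‖u‖ = 1 ∧ ‖evalPt p (symPt z w) / evalPt q (symPt z w)‖ ≤
      ‖evalPt p (symPt u w) / evalPt q (symPt u w)‖ := by
  have hd : DiffContOnCl ℂ (fun z => evalPt p (symPt z w) / evalPt q (symPt z w))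
      (Metric.ball 0 1) := by
    apply DifferentiableOn.diffContOnCl
    rw [closure_ball _ one_ne_zero]
    refine (differentiable_evalPt_symPt p w).differentiableOn.div
      (differentiable_evalPt_symPt q w).differentiableOn fun u hu => hq _ ?_
    exact symPt_mem_Gam.2 ⟨by simpa using hu, hw⟩
  obtain ⟨u, hu, hmax⟩ := Complex.exists_mem_frontier_isMaxOn_norm Metric.isBounded_ball
    ⟨0, by simp⟩ hd
  rw [frontier_ball _ one_ne_zero] at hu
  rw [closure_ball _ one_ne_zero] at hmax
  exact ⟨u, by simpa using hu, hmax (by simpa using hz)⟩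

lemma isBoundaryFor_symTorus : IsBoundaryFor Gam symTorus := by
  refine ⟨fun x hx => isClosed_Gam.frontier_subset (symTorus_subset_frontier hx),
    isClosed_symTorus, fun p q hq => ?_⟩
  obtain ⟨m, hm, hmax⟩ := isCompact_Gam.exists_isMaxOn Gam_nonempty
    (f := fun x => ‖evalPt p x / evalPt q x‖)
    (((continuous_evalPt p).continuousOn.div (continuous_evalPt q).continuousOn hq).norm)
  obtain ⟨z, w, rfl⟩ := exists_symPt m
  obtain ⟨hz, hw⟩ := symPt_mem_Gam.1 hm
  obtain ⟨u, hu, h1⟩ := exists_norm_eq_one_le p q hq hz hw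
  rw [symPt_comm u] at h1
  obtain ⟨v, hv, h2⟩ := exists_norm_eq_one_le p q hq hw hu.le
  exact ⟨symPt v u, ⟨v, u, hv, hu, rfl⟩, fun x hx => (hmax hx).trans (h1.trans h2)⟩

/-- Newton's recursion for the power sums `a ^ n + b ^ n` in terms of `e = a + b` and `m = a b`. -/
def powerSum (e m : MvPolynomial (Fin 2) ℂ) : ℕ → MvPolynomial (Fin 2) ℂ
  | 0 => 2
  | 1 => e
  | n + 2 => e * powerSum e m (n + 1) - m * powerSum e m n

/-- Turns the symmetric function `aⁿ + bⁿ` of two roots into a polynomial on `ℂ²` once `a + b` and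
`a b` are polynomials there. -/
lemma evalPt_powerSum {e m : MvPolynomial (Fin 2) ℂ} {x : ℂ × ℂ} {a b : ℂ}
    (he : evalPt e x = a + b) (hm : evalPt m x = a * b) (n : ℕ) :
    evalPt (powerSum e m n) x = a ^ n + b ^ n := by
  induction n using Nat.twoStepInduction with
  | zero =>
    simp only [powerSum, evalPt, map_ofNat, pow_zero]; norm_num
  | one => simp [powerSum, he]
  | more n h1 h2 =>
    have : evalPt (powerSum e m (n + 2)) x = evalPt e x * evalPt (powerSum e m (n + 1)) x -
        evalPt m x * evalPt (powerSum e m n) x := by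
      simp [powerSum, evalPt]
    rw [this, h1, h2, he, hm]; ring

/-- Equality case of the triangle inequality: `(1 + c̄ z) / 2` is a peak function at `c` for the
closed disc. -/
lemma norm_one_add_conj_mul_le {z c : ℂ} (hc : ‖c‖ = 1) (hz : ‖z‖ ≤ 1) :
    ‖1 + starRingEnd ℂ c * z‖ ≤ 2 ∧ (‖1 + starRingEnd ℂ c * z‖ = 2 → z = c) := by
  have hcc : starRingEnd ℂ c * c = 1 := by
    rw [mul_comm, Complex.mul_conj, Complex.normSq_eq_norm_sq, hc]; simp
  have h1 : ‖starRingEnd ℂ c * z‖ ≤ 1 := by rw [norm_mul, RCLike.norm_conj, hc, one_mul]; exact hz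
  refine ⟨(norm_add_le _ _).trans (by rw [norm_one]; linarith), fun h => ?_⟩
  set v := starRingEnd ℂ c * z with hv
  have hsq : ‖1 + v‖ ^ 2 = 4 := by rw [h]; norm_num
  have hvsq : ‖v‖ ^ 2 ≤ 1 := by nlinarith [norm_nonneg v]
  rw [← Complex.normSq_eq_norm_sq, Complex.normSq_apply] at hsq hvsq
  simp only [Complex.add_re, Complex.one_re, Complex.add_im, Complex.one_im, zero_add] at hsq
  have hre : v.re = 1 := by nlinarith [mul_self_nonneg v.im, mul_self_nonneg (v.re - 1)]
  have him : v.im = 0 := by nlinarith [mul_self_nonneg v.im]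
  have hv1 : v = 1 := Complex.ext hre him
  calc z = (starRingEnd ℂ c * c) * z := by rw [hcc, one_mul]
    _ = c * v := by rw [hv]; ring
    _ = c := by rw [hv1, mul_one]

/-- The function `a` peaks on the bidisc exactly at `(c, d)`. If `symPt c d ∉ C`, then the
symmetrized power `a(z,w)ⁿ + a(w,z)ⁿ`, a polynomial on `Γ`, is smaller than `1` in modulus on `C`
for large `n`, yet at least `1` at `symPt c d`. -/
lemma symTorus_subset_of_isBoundaryFor {C : Set (ℂ × ℂ)} (hC : IsBoundaryFor Gam C) :
    symTorus ⊆ C := by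
  rintro _ ⟨c, d, hc, hd, rfl⟩
  by_contra hnot
  set c' := starRingEnd ℂ c with hc'
  set d' := starRingEnd ℂ d with hd'
  have hcc : c' * c = 1 := by
    rw [hc', mul_comm, Complex.mul_conj, Complex.normSq_eq_norm_sq, hc]; simp
  have hdd : d' * d = 1 := by
    rw [hd', mul_comm, Complex.mul_conj, Complex.normSq_eq_norm_sq, hd]; simp
  let a : ℂ × ℂ → ℂ := fun x => (1 + c' * x.1) * (1 + d' * x.2) / 4
  have ha_cont : Continuous a := by fun_prop
  have ha : ∀ x ∈ bidisc, symPt x.1 x.2 ∈ C → ‖a x‖ < 1 := by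
    intro x hx hxC
    rw [mem_bidisc] at hx
    obtain ⟨h1, h1'⟩ := norm_one_add_conj_mul_le hc hx.1
    obtain ⟨h2, h2'⟩ := norm_one_add_conj_mul_le hd hx.2
    have hn : ‖a x‖ = ‖1 + c' * x.1‖ * ‖1 + d' * x.2‖ / 4 := by simp [a]
    rw [hn]
    by_contra! hge
    have e1 : ‖1 + c' * x.1‖ = 2 := by
      nlinarith [norm_nonneg (1 + c' * x.1), norm_nonneg (1 + d' * x.2)]
    have e2 : ‖1 + d' * x.2‖ = 2 := by
      nlinarith [norm_nonneg (1 + c' * x.1), norm_nonneg (1 + d' * x.2)]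
    rw [h1' e1, h2' e2] at hxC
    exact hnot hxC
  have hK : IsCompact (bidisc ∩ (fun x : ℂ × ℂ => symPt x.1 x.2) ⁻¹' C) :=
    isCompact_bidisc.inter_right (hC.2.1.preimage continuous_symPt)
  obtain ⟨ρ, hρ0, hρ1, hρ⟩ : ∃ ρ : ℝ, 0 ≤ ρ ∧ ρ < 1 ∧
      ∀ x ∈ bidisc, symPt x.1 x.2 ∈ C → ‖a x‖ ≤ ρ := by
    rcases (bidisc ∩ (fun x : ℂ × ℂ => symPt x.1 x.2) ⁻¹' C).eq_empty_or_nonempty with h | h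
    · refine ⟨0, le_rfl, one_pos, fun x hx hxC => ?_⟩
      exact absurd (Set.mem_inter hx hxC) (h ▸ Set.notMem_empty x)
    · obtain ⟨m, hm, hmax⟩ := hK.exists_isMaxOn h ha_cont.norm.continuousOn
      exact ⟨‖a m‖, norm_nonneg _, ha m hm.1 hm.2, fun x hx hxC => hmax ⟨hx, hxC⟩⟩
  obtain ⟨n, hn⟩ := exists_pow_lt_of_lt_one (show (0 : ℝ) < 1 / 2 by norm_num) hρ1
  let e : MvPolynomial (Fin 2) ℂ := MvPolynomial.C (1 / 4) * (2 +
    MvPolynomial.C (c' + d') * MvPolynomial.X 0 + MvPolynomial.C (2 * c' * d') * MvPolynomial.X 1)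
  let m : MvPolynomial (Fin 2) ℂ := MvPolynomial.C (1 / 16) *
    ((1 + MvPolynomial.C c' * MvPolynomial.X 0 + MvPolynomial.C (c' ^ 2) * MvPolynomial.X 1) *
    (1 + MvPolynomial.C d' * MvPolynomial.X 0 + MvPolynomial.C (d' ^ 2) * MvPolynomial.X 1))
  have hF : ∀ z w : ℂ, evalPt (powerSum e m n) (symPt z w) = a (z, w) ^ n + a (w, z) ^ n := by
    intro z w
    refine evalPt_powerSum ?_ ?_ n
    · simp [e, evalPt, a, symPt]; ring
    · simp [m, evalPt, a, symPt]; ring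
  obtain ⟨k, hk, hmax⟩ := hC.2.2 (powerSum e m n) 1 (by simp [evalPt])
  have h1 := hmax (symPt c d) (symPt_mem_Gam.2 ⟨hc.le, hd.le⟩)
  obtain ⟨z, w, rfl⟩ := exists_symPt k
  obtain ⟨hz, hw⟩ := symPt_mem_Gam.1 (hC.1 hk)
  have h11 : ∀ x, evalPt 1 x = 1 := by simp [evalPt]
  rw [h11, h11, div_one, div_one, hF, hF] at h1
  have hup : ‖a (z, w) ^ n + a (w, z) ^ n‖ < 1 := by
    have e1 := hρ (z, w) (mem_bidisc.2 ⟨hz, hw⟩) hk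
    have e2 := hρ (w, z) (mem_bidisc.2 ⟨hw, hz⟩) (by simpa [symPt_comm w z] using hk)
    refine (norm_add_le _ _).trans_lt ?_
    rw [norm_pow, norm_pow]
    have := pow_le_pow_left₀ (norm_nonneg _) e1 n
    have := pow_le_pow_left₀ (norm_nonneg _) e2 n
    linarith
  have hlow : 1 ≤ ‖a (c, d) ^ n + a (d, c) ^ n‖ := by
    have e1 : a (c, d) = 1 := by simp only [a, hcc, hdd]; norm_num
    -- The swapped term is a nonnegative real, so it cannot cancel `a (c, d) ^ n = 1`.
    have e2 : a (d, c) = ((Complex.normSq (1 + c' * d) / 4 : ℝ) : ℂ) := by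
      rw [Complex.ofReal_div, ← Complex.mul_conj]
      simp only [a, hc', hd', map_add, map_mul, map_one, Complex.conj_conj, Complex.ofReal_ofNat]
      ring
    rw [e1, e2, one_pow, ← Complex.ofReal_pow, ← Complex.ofReal_one, ← Complex.ofReal_add,
      Complex.norm_real, Real.norm_eq_abs]
    have : 0 ≤ (Complex.normSq (1 + c' * d) / 4) ^ n :=
      pow_nonneg (div_nonneg (Complex.normSq_nonneg _) (by norm_num)) _
    exact le_abs.2 (Or.inl (le_add_of_nonneg_right this))
  linarith

lemma distBoundary_Gam : distBoundary Gam = symTorus := by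
  apply subset_antisymm
  · exact Set.sInter_subset_of_mem isBoundaryFor_symTorus
  · exact Set.subset_sInter fun C hC => symTorus_subset_of_isBoundaryFor hC

/-! ### Distinguished polynomials -/

lemma isGammaDistinguishedPoly_iff {q : MvPolynomial (Fin 2) ℂ} :
    IsGammaDistinguishedPoly q ↔ (zeroSet q ∩ G2).Nonempty ∧
      ∀ x ∈ frontier Gam, evalPt q x = 0 → x ∈ symTorus := by
  unfold IsGammaDistinguishedPoly
  rw [distBoundary_Gam]
  refine and_congr_right fun _ => ⟨fun h x hx hq => ?_, fun h => ?_⟩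
  · exact (h.subset ⟨hq, hx⟩).2
  · exact subset_antisymm (fun x hx => ⟨hx.1, h x hx.2 hx.1⟩)
      (fun x hx => ⟨hx.1, symTorus_subset_frontier hx.2⟩)

/-- The point `(l, 0)` lies on `∂Γ`, but points of the symmetrized torus have a unimodular second
coordinate. -/
lemma IsGammaDistinguishedPoly.eval_ne_zero {q : MvPolynomial (Fin 2) ℂ}
    (hq : IsGammaDistinguishedPoly q) {l : ℂ} (hl : ‖l‖ = 1) : evalPt q (l, 0) ≠ 0 := by
  intro h
  have hl0 : ((l, 0) : ℂ × ℂ) = symPt l 0 := by simp [symPt]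
  obtain ⟨z, w, hz, hw, hzw⟩ := (isGammaDistinguishedPoly_iff.1 hq).2 (l, 0)
    (hl0 ▸ symPt_mem_frontier hl (by simp)) h
  have : ‖z * w‖ = 0 := by
    have : z * w = 0 := (congrArg Prod.snd hzw).symm
    rw [this, norm_zero]
  rw [norm_mul, hz, hw] at this
  norm_num at this

/-- The polynomial `s - λ - λ̄ p`. -/
def linPoly (l : ℂ) : MvPolynomial (Fin 2) ℂ :=
  MvPolynomial.X 0 - MvPolynomial.C l - MvPolynomial.C (starRingEnd ℂ l) * MvPolynomial.X 1

lemma norm_sub_eq_norm_one_sub_conj_mul {l z : ℂ} (hl : ‖l‖ < 1) (hz : ‖z‖ = 1) :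
    ‖l - z‖ = ‖1 - starRingEnd ℂ l * z‖ ∧ 1 - starRingEnd ℂ l * z ≠ 0 := by
  have hzz : z * starRingEnd ℂ z = 1 := by
    rw [Complex.mul_conj, Complex.normSq_eq_norm_sq, hz]; simp
  constructor
  · rw [← RCLike.norm_conj (l - z), ← one_mul ‖starRingEnd ℂ (l - z)‖, ← hz, ← norm_mul,
      ← norm_neg]
    congr 1
    rw [map_sub]
    linear_combination hzz
  · intro h
    have : ‖starRingEnd ℂ l * z‖ = 1 := by rw [← sub_eq_zero.1 h, norm_one]
    rw [norm_mul, RCLike.norm_conj, hz] at this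
    linarith

/-- On the zero set `w = (l - z) / (1 - l̄ z)`, a disc automorphism of `z`, so one root is
unimodular iff the other is; on `∂Γ` at least one of them is. -/
lemma mem_symTorus_of_linPoly {l : ℂ} (hl : ‖l‖ < 1) {x : ℂ × ℂ} (hx : x ∈ frontier Gam)
    (h : evalPt (linPoly l) x = 0) : x ∈ symTorus := by
  obtain ⟨z, w, rfl⟩ := exists_symPt x
  have h0 : z + w - l - starRingEnd ℂ l * (z * w) = 0 := by
    simpa [evalPt, linPoly, symPt] using h
  obtain ⟨hz, hw⟩ := symPt_mem_Gam.1 (isClosed_Gam.frontier_subset hx)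
  have hnot := frontier_Gam_disjoint_G2 hx
  rw [symPt_mem_G2] at hnot
  have key : ∀ {a b : ℂ}, ‖a‖ = 1 → a + b - l - starRingEnd ℂ l * (a * b) = 0 → ‖b‖ = 1 := by
    intro a b ha hab
    obtain ⟨h1, h2⟩ := norm_sub_eq_norm_one_sub_conj_mul hl ha
    have : l - a = (1 - starRingEnd ℂ l * a) * b := by linear_combination -hab
    rw [this, norm_mul] at h1
    exact (mul_eq_left₀ (norm_ne_zero_iff.2 h2)).1 h1
  by_cases hz1 : ‖z‖ = 1
  · exact ⟨z, w, hz1, key hz1 h0, rfl⟩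
  · have hw1 : ‖w‖ = 1 := by
      by_contra hw1
      exact hnot ⟨lt_of_le_of_ne hz hz1, lt_of_le_of_ne hw hw1⟩
    exact ⟨z, w, key (a := w) hw1 (by linear_combination h0), hw1, rfl⟩

lemma IsGammaDistinguishedPoly.mul_linPoly {q : MvPolynomial (Fin 2) ℂ}
    (hq : IsGammaDistinguishedPoly q) {l : ℂ} (hl : ‖l‖ < 1) :
    IsGammaDistinguishedPoly (linPoly l * q) := by
  rw [isGammaDistinguishedPoly_iff] at hq ⊢
  obtain ⟨⟨x, hx, hxG⟩, hf⟩ := hq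
  refine ⟨⟨x, ?_, hxG⟩, fun y hy h => ?_⟩
  · change evalPt _ x = 0
    rw [evalPt_mul, show evalPt q x = 0 from hx, mul_zero]
  · rw [evalPt_mul] at h
    rcases mul_eq_zero.1 h with h | h
    · exact mem_symTorus_of_linPoly hl hy h
    · exact hf y hy h

/-! ### Polynomial convexity of the closed symmetrized bidisc -/

lemma evalPt_le_sSup (p : MvPolynomial (Fin 2) ℂ) {x : ℂ × ℂ} (hx : x ∈ Gam) :
    ‖evalPt p x‖ ≤ sSup ((fun y => ‖evalPt p y‖) '' Gam) :=
  le_csSup (isCompact_Gam.image (continuous_evalPt p).norm).bddAbove ⟨x, hx, rfl⟩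

lemma sSup_le_of_forall {p : MvPolynomial (Fin 2) ℂ} {c : ℝ} (h : ∀ x ∈ Gam, ‖evalPt p x‖ ≤ c) :
    sSup ((fun y => ‖evalPt p y‖) '' Gam) ≤ c := by
  refine csSup_le (Gam_nonempty.image _) ?_
  rintro _ ⟨x, hx, rfl⟩
  exact h x hx

/-- Since `2 (z w)ⁿ = (zⁿ + wⁿ)² - (z²ⁿ + w²ⁿ)` is bounded, `|z w| ≤ 1`. If `|z| > 1`, then `|w| ≤
1`, and `zⁿ = (zⁿ + wⁿ) - wⁿ` would be bounded, which is absurd. -/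
lemma norm_le_one_of_forall_powerSum {z w : ℂ} (h : ∀ n : ℕ, ‖z ^ n + w ^ n‖ ≤ 2) : ‖z‖ ≤ 1 := by
  have bound : ∀ {v : ℂ} {c : ℝ}, (∀ n : ℕ, ‖v‖ ^ n ≤ c) → ‖v‖ ≤ 1 := by
    intro v c hv
    by_contra! hgt
    obtain ⟨n, hn⟩ := pow_unbounded_of_one_lt c hgt
    exact absurd (hv n) (not_le.2 hn)
  have hzw : ‖z * w‖ ≤ 1 := by
    refine bound (c := 3) fun n => ?_
    have e : 2 * (z * w) ^ n = (z ^ n + w ^ n) ^ 2 - (z ^ (2 * n) + w ^ (2 * n)) := by ring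
    have h1 : ‖2 * (z * w) ^ n‖ ≤ 2 ^ 2 + 2 := by
      rw [e]
      refine (norm_sub_le _ _).trans (add_le_add ?_ (h _))
      rw [norm_pow]
      exact pow_le_pow_left₀ (norm_nonneg _) (h n) 2
    rw [norm_mul, norm_pow] at h1
    norm_num at h1
    rw [norm_mul]
    linarith
  by_contra! hgt
  have hw : ‖w‖ ≤ 1 := by
    rw [norm_mul] at hzw
    nlinarith [norm_nonneg w]
  refine absurd (bound (v := z) (c := 3) fun n => ?_) (not_le.2 hgt)
  rw [← norm_pow]
  calc ‖z ^ n‖ = ‖(z ^ n + w ^ n) - w ^ n‖ := by ring_nf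
    _ ≤ ‖z ^ n + w ^ n‖ + ‖w ^ n‖ := norm_sub_le _ _
    _ ≤ 2 + 1 := add_le_add (h n) (by rw [norm_pow]; exact pow_le_one₀ (norm_nonneg _) hw)
    _ = 3 := by norm_num

/-- Polynomial convexity of `Γ`; testing on power sums, which are bounded by `2` on `Γ`, already
suffices. -/
lemma mem_Gam_of_forall_le {x : ℂ × ℂ}
    (h : ∀ p, ‖evalPt p x‖ ≤ sSup ((fun y => ‖evalPt p y‖) '' Gam)) : x ∈ Gam := by
  obtain ⟨z, w, rfl⟩ := exists_symPt x
  have hps : ∀ (a b : ℂ) (n : ℕ), evalPt (powerSum (MvPolynomial.X 0) (MvPolynomial.X 1) n)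
      (symPt a b) = a ^ n + b ^ n := fun a b n =>
    evalPt_powerSum (by simp [evalPt, symPt]) (by simp [evalPt, symPt]) n
  have key : ∀ n : ℕ, ‖z ^ n + w ^ n‖ ≤ 2 := by
    intro n
    rw [← hps]
    refine (h _).trans (sSup_le_of_forall fun y hy => ?_)
    obtain ⟨a, b, rfl⟩ := exists_symPt y
    obtain ⟨ha, hb⟩ := symPt_mem_Gam.1 hy
    rw [hps]
    refine (norm_add_le _ _).trans ?_
    rw [norm_pow, norm_pow]
    have := pow_le_one₀ (norm_nonneg a) ha (n := n)
    have := pow_le_one₀ (norm_nonneg b) hb (n := n)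
    linarith
  refine symPt_mem_Gam.2 ⟨norm_le_one_of_forall_powerSum key,
    norm_le_one_of_forall_powerSum (w := z) fun n => ?_⟩
  rw [add_comm]; exact key n

/-! ### Approximating reciprocals by polynomials -/

instance : CompactSpace Gam := isCompact_iff_compactSpace.1 isCompact_Gam

/-- Restriction of polynomials to `Γ`, as an algebra homomorphism into `C(Γ)`. -/
def polyRestrict : MvPolynomial (Fin 2) ℂ →ₐ[ℂ] C(Gam, ℂ) :=
  MvPolynomial.aeval ![⟨fun x => x.1.1, by fun_prop⟩, ⟨fun x => x.1.2, by fun_prop⟩]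

lemma polyRestrict_apply (p : MvPolynomial (Fin 2) ℂ) (x : Gam) :
    polyRestrict p x = evalPt p x := by
  have : (ContinuousMap.evalAlgHom ℂ ℂ x).comp polyRestrict =
      MvPolynomial.aeval ![x.1.1, x.1.2] := by
    refine MvPolynomial.algHom_ext fun i => ?_
    fin_cases i <;> simp [polyRestrict]
  have h := DFunLike.congr_fun this p
  simpa [evalPt, MvPolynomial.aeval_eq_eval] using h

lemma norm_polyRestrict_le (p : MvPolynomial (Fin 2) ℂ) :
    ‖polyRestrict p‖ ≤ sSup ((fun y => ‖evalPt p y‖) '' Gam) := by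
  refine (ContinuousMap.norm_le _ ?_).2 fun x => ?_
  · obtain ⟨x, hx⟩ := Gam_nonempty
    exact (norm_nonneg _).trans (evalPt_le_sSup p hx)
  · rw [polyRestrict_apply]; exact evalPt_le_sSup p x.2

/-- Gelfand theory: a character of `B` pulls back to evaluation at a point, which lies in `Γ` by
polynomial convexity, so no character vanishes on `φ q` and `φ q` is invertible. Density
approximates the inverse by a polynomial. -/
lemma exists_approx_inverse_of_denseRange {B : Type*} [NormedCommRing B] [NormedAlgebra ℂ B]
    [CompleteSpace B] [NormOneClass B] (φ : MvPolynomial (Fin 2) ℂ →ₐ[ℂ] B) (hφ : DenseRange φ)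
    (hle : ∀ p, ‖φ p‖ ≤ sSup ((fun y => ‖evalPt p y‖) '' Gam))
    {q : MvPolynomial (Fin 2) ℂ} (hq : ∀ x ∈ Gam, evalPt q x ≠ 0) {ε : ℝ} (hε : 0 < ε) :
    ∃ r, ‖φ (r * q - 1)‖ ≤ ε := by
  have hunit : IsUnit (φ q) := by
    by_contra hnot
    obtain ⟨χ, hχ⟩ := WeakDual.CharacterSpace.exists_apply_eq_zero hnot
    let ψ : MvPolynomial (Fin 2) ℂ →ₐ[ℂ] ℂ :=
      (WeakDual.CharacterSpace.toAlgHom χ).comp φ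
    let l : ℂ × ℂ := (ψ (MvPolynomial.X 0), ψ (MvPolynomial.X 1))
    have hψ : ∀ p, ψ p = evalPt p l := by
      intro p
      have : ψ = MvPolynomial.aeval ![l.1, l.2] := by
        refine MvPolynomial.algHom_ext fun i => ?_
        fin_cases i <;> simp [l]
      rw [this]
      simp [evalPt, MvPolynomial.aeval_eq_eval]
    have hl : l ∈ Gam := mem_Gam_of_forall_le fun p => by
      rw [← hψ]
      exact (AlgHom.norm_apply_le_self (WeakDual.CharacterSpace.toAlgHom χ) (φ p)).trans (hle p)
    exact hq l hl (by rw [← hψ]; exact hχ)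
  obtain ⟨g, hg⟩ := hunit.exists_left_inv
  obtain ⟨r, hr⟩ := hφ.exists_dist_lt g (show 0 < ε / (‖φ q‖ + 1) by positivity)
  refine ⟨r, ?_⟩
  have e : φ (r * q - 1) = (φ r - g) * φ q := by
    rw [map_sub, map_mul, map_one, sub_mul, hg]
  rw [e]
  refine (norm_mul_le _ _).trans ?_
  rw [dist_comm, dist_eq_norm] at hr
  calc ‖φ r - g‖ * ‖φ q‖ ≤ ε / (‖φ q‖ + 1) * (‖φ q‖ + 1) := by
        gcongr; linarith
    _ = ε := by field_simp

lemma exists_approx_inverse {q : MvPolynomial (Fin 2) ℂ} (hq : ∀ x ∈ Gam, evalPt q x ≠ 0)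
    {ε : ℝ} (hε : 0 < ε) :
    ∃ r : MvPolynomial (Fin 2) ℂ, ∀ x ∈ Gam, ‖evalPt (r * q - 1) x‖ ≤ ε := by
  obtain ⟨B, hB, hle, hcl⟩ : ∃ B : Subalgebra ℂ C(Gam, ℂ), IsClosed (B : Set C(Gam, ℂ)) ∧
      (∀ p, polyRestrict p ∈ B) ∧ ∀ g ∈ B, g ∈ closure (Set.range polyRestrict) :=
    ⟨polyRestrict.range.topologicalClosure, Subalgebra.isClosed_topologicalClosure _,
      fun p => Subalgebra.le_topologicalClosure _ ⟨p, rfl⟩, fun g hg => hg⟩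
  have : CompleteSpace B := hB.completeSpace_coe
  have : Nonempty Gam := Gam_nonempty.to_subtype
  have : NormOneClass B := ⟨norm_one (α := C(Gam, ℂ))⟩
  let φ : MvPolynomial (Fin 2) ℂ →ₐ[ℂ] B := polyRestrict.codRestrict B hle
  have hφ : DenseRange φ := by
    intro g
    rw [Metric.mem_closure_iff]
    intro δ hδ
    obtain ⟨_, ⟨r, rfl⟩, hr⟩ := Metric.mem_closure_iff.1 (hcl g g.2) δ hδ
    exact ⟨φ r, ⟨r, rfl⟩, hr⟩
  obtain ⟨r, hr⟩ := exists_approx_inverse_of_denseRange φ hφ norm_polyRestrict_le hq hε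
  refine ⟨r, fun x hx => ?_⟩
  rw [← polyRestrict_apply _ ⟨x, hx⟩]
  exact (ContinuousMap.norm_coe_le_norm _ _).trans hr

/-! ### Polynomials in a commuting pair -/

section Operators

variable {H : Type*} [NormedAddCommGroup H] [InnerProductSpace ℂ H]
variable {K : Type*} [NormedAddCommGroup K] [InnerProductSpace ℂ K]

/-- Serves for the zeroth coordinate of `ℓ²`, for the embedding `tailEmb` and for the projection
`dilFst`. -/
lemma polyOp_intertwine (p : MvPolynomial (Fin 2) ℂ) {S P : H →L[ℂ] H} {S' P' : K →L[ℂ] K}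
    (W : H →ₗ[ℂ] K) (hS : ∀ x, W (S x) = S' (W x)) (hP : ∀ x, W (P x) = P' (W x)) (x : H) :
    W (polyOp p S P x) = polyOp p S' P' (W x) := by
  have pow : ∀ {X : H →L[ℂ] H} {Y : K →L[ℂ] K} (_ : ∀ x, W (X x) = Y (W x)) (n : ℕ) (x : H),
      W ((X ^ n) x) = (Y ^ n) (W x) := by
    intro X Y h n
    induction n with
    | zero => intro x; rfl
    | succ n ih =>
      intro x
      rw [pow_succ, pow_succ, mul_apply_eq_comp, mul_apply_eq_comp, ih, h]
  simp only [polyOp, sum_apply, map_sum, smul_apply,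
    map_smul, mul_apply_eq_comp, pow hS, pow hP]

-- `MvPolynomial.aeval` needs a commutative target, so the homomorphism is built into the subalgebra
-- generated by `S` and `P`.
open scoped IsMulCommutative in
lemma exists_polyOp_algHom {S P : H →L[ℂ] H} (h : Commute S P) :
    ∃ φ : MvPolynomial (Fin 2) ℂ →ₐ[ℂ] (H →L[ℂ] H), (∀ p, φ p = polyOp p S P) ∧
      φ (MvPolynomial.X 0) = S ∧ φ (MvPolynomial.X 1) = P := by
  let s : Set (H →L[ℂ] H) := {S, P}
  have hs : ∀ a ∈ s, ∀ b ∈ s, a * b = b * a := by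
    rintro a (rfl | rfl) b (rfl | rfl)
    · rfl
    · exact h
    · exact h.symm
    · rfl
  have : IsMulCommutative (Algebra.adjoin ℂ s) := Algebra.isMulCommutative_adjoin ℂ hs
  let S' : Algebra.adjoin ℂ s := ⟨S, Algebra.subset_adjoin (by simp [s])⟩
  let P' : Algebra.adjoin ℂ s := ⟨P, Algebra.subset_adjoin (by simp [s])⟩
  let ψ : MvPolynomial (Fin 2) ℂ →ₐ[ℂ] Algebra.adjoin ℂ s := MvPolynomial.aeval ![S', P']
  refine ⟨(Algebra.adjoin ℂ s).val.comp ψ, fun p => ?_, ?_, ?_⟩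
  · have h1 : ψ p = ∑ m ∈ p.support, p.coeff m • (S' ^ m 0 * P' ^ m 1) := by
      simp only [ψ, MvPolynomial.aeval_def, MvPolynomial.eval₂_eq', Fin.prod_univ_two,
        Algebra.smul_def]
      rfl
    rw [AlgHom.comp_apply, h1, map_sum]
    simp only [map_smul, map_mul, map_pow]
    rfl
  · simp [ψ, S']
  · simp [ψ, P']

lemma polyOp_mul {S P : H →L[ℂ] H} (h : Commute S P) (p q : MvPolynomial (Fin 2) ℂ) :
    polyOp (p * q) S P = polyOp p S P * polyOp q S P := by
  obtain ⟨φ, hφ, -⟩ := exists_polyOp_algHom h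
  simp only [← hφ, map_mul]

lemma polyOp_linPoly {S P : H →L[ℂ] H} (h : Commute S P) (l : ℂ) :
    polyOp (linPoly l) S P = S - l • 1 - starRingEnd ℂ l • P := by
  obtain ⟨φ, hφ, h0, h1⟩ := exists_polyOp_algHom h
  rw [← hφ, linPoly, map_sub, map_sub, map_mul, h0, h1, ← MvPolynomial.algebraMap_eq,
    AlgHom.commutes, AlgHom.commutes, Algebra.algebraMap_eq_smul_one,
    Algebra.algebraMap_eq_smul_one, smul_mul_assoc, one_mul]

lemma exists_sub_eval_eq (p : MvPolynomial (Fin 2) ℂ) (l : ℂ × ℂ) :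
    ∃ a b : MvPolynomial (Fin 2) ℂ, p - MvPolynomial.C (evalPt p l) =
      (MvPolynomial.X 0 - MvPolynomial.C l.1) * a +
      (MvPolynomial.X 1 - MvPolynomial.C l.2) * b := by
  induction p using MvPolynomial.induction_on with
  | C c => exact ⟨0, 0, by simp [evalPt]⟩
  | add p q hp hq =>
    obtain ⟨a, b, h⟩ := hp
    obtain ⟨a', b', h'⟩ := hq
    refine ⟨a + a', b + b', ?_⟩
    have : evalPt (p + q) l = evalPt p l + evalPt q l := map_add _ _ _
    rw [this, map_add]
    linear_combination h + h'
  | mul_X p i hp =>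
    obtain ⟨a, b, h⟩ := hp
    have e : evalPt (p * MvPolynomial.X i) l = evalPt p l * ![l.1, l.2] i := by simp [evalPt]
    rw [e, map_mul]
    fin_cases i
    · refine ⟨a * MvPolynomial.X 0 + MvPolynomial.C (evalPt p l), b * MvPolynomial.X 0, ?_⟩
      simp only [Fin.zero_eta, Matrix.cons_val_zero]
      linear_combination MvPolynomial.X 0 * h
    · refine ⟨a * MvPolynomial.X 1, b * MvPolynomial.X 1 + MvPolynomial.C (evalPt p l), ?_⟩
      simp only [Fin.mk_one, Matrix.cons_val_one, Matrix.cons_val_fin_one]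
      linear_combination MvPolynomial.X 1 * h

/-- The pair `(a, b)`, corrected by the inverse `R` of `M a + N b`, is a contracting homotopy of the
Koszul complex; `R` commutes with `M` and `N` because `M a + N b` does. -/
lemma koszulExact_of_isUnit {M N a b : H →L[ℂ] H} (hMN : Commute M N) (hMa : Commute M a)
    (hMb : Commute M b) (hNa : Commute N a) (hNb : Commute N b)
    (hu : IsUnit (M * a + N * b)) : KoszulExact M N := by
  obtain ⟨R, hR, hR'⟩ : ∃ R, R * (M * a + N * b) = 1 ∧ (M * a + N * b) * R = 1 := by
    obtain ⟨u, hu⟩ := hu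
    exact ⟨↑u⁻¹, by rw [← hu]; exact u.inv_mul, by rw [← hu]; exact u.mul_inv⟩
  have hMG : Commute M (M * a + N * b) :=
    ((Commute.refl M).mul_right hMa).add_right (hMN.mul_right hMb)
  have hNG : Commute N (M * a + N * b) :=
    (hMN.symm.mul_right hNa).add_right ((Commute.refl N).mul_right hNb)
  have comm_inv : ∀ X : H →L[ℂ] H, Commute X (M * a + N * b) → X * R = R * X := by
    intro X hX
    calc X * R = R * (M * a + N * b) * X * R := by rw [hR, one_mul]
      _ = R * (X * (M * a + N * b)) * R := by rw [hX.eq, mul_assoc R]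
      _ = R * X * ((M * a + N * b) * R) := by noncomm_ring
      _ = R * X := by rw [hR', mul_one]
  have hMR := comm_inv M hMG
  have hNR := comm_inv N hNG
  have app : ∀ {X Y : H →L[ℂ] H}, X = Y → ∀ x, X x = Y x := fun h x => by rw [h]
  refine ⟨fun x hx hx' => ?_, fun x y h => ?_, fun w => ?_⟩
  · have e : R * (M * a + N * b) = R * (a * M + b * N) := by rw [hMa.eq, hNb.eq]
    have := app (e.symm.trans hR) x
    simpa [hx, hx'] using this.symm
  · have h' : M y = N x := sub_eq_zero.1 h
    refine ⟨R (a x + b y), ?_, ?_⟩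
    · have e1 := app hMR (a x + b y)
      have e2 := app hMa.eq x
      have e3 := app hMb.eq y
      have e4 := app hNb.eq x
      have e5 := app hR x
      simp only [mul_apply_eq_comp, add_apply,
        one_apply_eq_self] at e1 e2 e3 e4 e5
      rw [e1, map_add, e3, h', ← e4, e5]
    · have e1 := app hNR (a x + b y)
      have e2 := app hNa.eq x
      have e3 := app hNb.eq y
      have e4 := app hMa.eq y
      have e5 := app hR y
      simp only [mul_apply_eq_comp, add_apply,
        one_apply_eq_self] at e1 e2 e3 e4 e5
      rw [e1, map_add, e2, ← h', ← e4, e5]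
  · refine ⟨-b (R w), a (R w), ?_⟩
    have := app hR' w
    simpa using this

/-! ### `Γ`-contractions characterized by polynomials alone. -/

variable [CompleteSpace H]

/-- For `l ∉ Γ` some `p` has `|p(l)| > sup_Γ |p| ≥ ‖p(S, P)‖`, so `p(S, P) - p(l)` is invertible; it
has the form `(S - l₁) a + (P - l₂) b`, which makes the Koszul complex exact. -/
lemma taylorSpectrum_subset {S P : H →L[ℂ] H} (hc : Commute S P)
    (h : ∀ p, ‖polyOp p S P‖ ≤ sSup ((fun y => ‖evalPt p y‖) '' Gam)) :
    taylorSpectrum S P ⊆ Gam := by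
  intro l hl
  by_contra hnot
  obtain ⟨p, hp⟩ : ∃ p, sSup ((fun y => ‖evalPt p y‖) '' Gam) < ‖evalPt p l‖ := by
    by_contra! hall
    exact hnot (mem_Gam_of_forall_le hall)
  obtain ⟨φ, hφ, h0, h1⟩ := exists_polyOp_algHom hc
  obtain ⟨a, b, hab⟩ := exists_sub_eval_eq p l
  have hcomm : ∀ f g, Commute (φ f) (φ g) := fun f g => by
    rw [commute_iff_eq, ← map_mul, mul_comm, map_mul]
  have hC : ∀ c : ℂ, φ (MvPolynomial.C c) = c • 1 := fun c => by
    rw [← MvPolynomial.algebraMap_eq, AlgHom.commutes, Algebra.algebraMap_eq_smul_one]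
  have hM : S - l.1 • (1 : H →L[ℂ] H) = φ (MvPolynomial.X 0 - MvPolynomial.C l.1) := by
    rw [map_sub, h0, hC]
  have hN : P - l.2 • (1 : H →L[ℂ] H) = φ (MvPolynomial.X 1 - MvPolynomial.C l.2) := by
    rw [map_sub, h1, hC]
  apply hl
  rw [hM, hN]
  refine koszulExact_of_isUnit (hcomm _ _) (hcomm _ a) (hcomm _ b) (hcomm _ _) (hcomm _ _) ?_
  rw [← map_mul, ← map_mul, ← map_add, ← hab, map_sub, hφ, hC]
  have hlt : ‖polyOp p S P‖ * ‖(1 : H →L[ℂ] H)‖ < ‖evalPt p l‖ :=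
    ((mul_le_of_le_one_right (norm_nonneg _) ContinuousLinearMap.norm_id_le).trans (h p)).trans_lt
      hp
  have := spectrum.mem_resolventSet_of_norm_lt_mul hlt
  rw [spectrum.mem_resolventSet_iff, Algebra.algebraMap_eq_smul_one] at this
  rw [← neg_sub]
  exact this.neg

lemma isGammaContraction_iff {S P : H →L[ℂ] H} :
    IsGammaContraction S P ↔ Commute S P ∧
      ∀ p, ‖polyOp p S P‖ ≤ sSup ((fun y => ‖evalPt p y‖) '' Gam) := by
  refine and_congr_right fun hc => ?_
  obtain ⟨φ, hφ, -⟩ := exists_polyOp_algHom hc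
  constructor
  · rintro ⟨-, h⟩ p
    have h1 : polyOp 1 S P = 1 := by rw [← hφ, map_one]
    have := h p 1 (by simp [evalPt]) 1 (by rw [h1, one_mul]) (by rw [h1, one_mul])
    simpa [evalPt] using this
  · intro h
    refine ⟨taylorSpectrum_subset hc h, fun p q hq R hRq hqR => ?_⟩
    set M := sSup ((fun x => ‖evalPt p x / evalPt q x‖) '' Gam) with hM
    have hMle : ∀ x ∈ Gam, ‖evalPt p x / evalPt q x‖ ≤ M := fun x hx =>
      le_csSup (isCompact_Gam.image_of_continuousOn
        ((continuous_evalPt p).continuousOn.div (continuous_evalPt q).continuousOn hq).norm).bddAbove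
        ⟨x, hx, rfl⟩
    have hM0 : 0 ≤ M := by
      obtain ⟨x, hx⟩ := Gam_nonempty
      exact (norm_nonneg _).trans (hMle x hx)
    have key : ∀ ε : ℝ, 0 < ε → ‖polyOp p S P * R‖ ≤ M + ε * (M + ‖polyOp p S P‖ * ‖R‖) := by
      intro ε hε
      obtain ⟨r, hr⟩ := exists_approx_inverse hq hε
      -- Replaces `p / q` by the polynomial `p r` with `r ≈ 1 / q` on `Γ`; the error is controlled
      -- by `r q - 1` and vanishes with `ε`.
      have e : polyOp p S P * R =
          polyOp (p * r) S P - polyOp p S P * polyOp (r * q - 1) S P * R := by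
        simp only [← hφ, map_mul, map_sub, map_one] at hqR ⊢
        have : φ p * (φ r * φ q - 1) * R = φ p * φ r * (φ q * R) - φ p * R := by noncomm_ring
        rw [this, hqR]; noncomm_ring
      have b1 : ‖polyOp (p * r) S P‖ ≤ M * (1 + ε) := by
        refine (h _).trans (sSup_le_of_forall fun x hx => ?_)
        have hq0 := hq x hx
        have e1 : evalPt (p * r) x = evalPt p x / evalPt q x * (evalPt (r * q - 1) x + 1) := by
          have : evalPt (r * q - 1) x = evalPt r x * evalPt q x - 1 := by simp [evalPt]
          rw [this, evalPt_mul]; field_simp; ring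
        rw [e1, norm_mul]
        refine mul_le_mul (hMle x hx) ?_ (norm_nonneg _) hM0
        refine (norm_add_le _ _).trans ?_
        rw [norm_one, add_comm]
        exact add_le_add le_rfl (hr x hx)
      have b2 : ‖polyOp p S P * polyOp (r * q - 1) S P * R‖ ≤ ‖polyOp p S P‖ * ε * ‖R‖ := by
        refine (norm_mul_le _ _).trans ?_
        gcongr
        refine (norm_mul_le _ _).trans ?_
        gcongr
        exact (h _).trans (sSup_le_of_forall hr)
      rw [e]
      refine (norm_sub_le _ _).trans ((add_le_add b1 b2).trans (le_of_eq ?_))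
      ring
    have hlim : Tendsto (fun ε : ℝ => M + ε * (M + ‖polyOp p S P‖ * ‖R‖)) (𝓝[>] 0)
        (𝓝 (M + 0 * (M + ‖polyOp p S P‖ * ‖R‖))) :=
      ((continuous_const.add (continuous_id.mul continuous_const)).tendsto 0).mono_left
        nhdsWithin_le_nhds
    rw [zero_mul, add_zero] at hlim
    exact ge_of_tendsto hlim (eventually_nhdsWithin_of_forall fun ε hε => key ε hε)

lemma IsGammaContraction.norm_snd_le_one {S P : H →L[ℂ] H} (h : IsGammaContraction S P) :
    ‖P‖ ≤ 1 := by
  obtain ⟨hc, h⟩ := isGammaContraction_iff.1 h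
  obtain ⟨φ, hφ, -, h1⟩ := exists_polyOp_algHom hc
  have := h (MvPolynomial.X 1)
  rw [← hφ, h1] at this
  refine this.trans (sSup_le_of_forall fun x hx => ?_)
  obtain ⟨z, w, rfl⟩ := exists_symPt x
  obtain ⟨hz, hw⟩ := symPt_mem_Gam.1 hx
  simp only [evalPt, symPt, MvPolynomial.eval_X, Matrix.cons_val_one, Matrix.cons_val_fin_one,
    norm_mul]
  exact mul_le_one₀ hz (norm_nonneg _) hw

end Operators

/-! ### The Toeplitz pair on `ℓ²(E)` -/

lemma norm_headOp {E : Type*} [NormedAddCommGroup E] [InnerProductSpace ℂ E] (x : E) :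
    ‖headOp x‖ = ‖x‖ :=
  lp.norm_single (E := fun _ : ℕ => E) (p := 2) (by norm_num) 0 x

section Toeplitz

variable {E : Type*} [NormedAddCommGroup E] [InnerProductSpace ℂ E] [CompleteSpace E]

/-- The analytic Toeplitz operator on `ℓ²(E)` with symbol `A + z A*`. -/
def toepOp (A : E →L[ℂ] E) : ell2 E →L[ℂ] ell2 E := diagOp A + shiftOp ∘L diagOp (star A)

lemma toepOp_zero (A : E →L[ℂ] E) (y : ell2 E) : toepOp A y 0 = A (y 0) := by
  change A (y 0) + shiftOp (diagOp (star A) y) 0 = _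
  rw [shiftOp_zero, add_zero]

lemma toepOp_succ (A : E →L[ℂ] E) (y : ell2 E) (n : ℕ) :
    toepOp A y (n + 1) = A (y (n + 1)) + star A (y n) := rfl

lemma commute_toepOp_shiftOp (A : E →L[ℂ] E) : Commute (toepOp A) (shiftOp (E := E)) := by
  refine ContinuousLinearMap.ext fun y => ?_
  ext n
  change toepOp A (shiftOp y) n = shiftOp (toepOp A y) n
  rcases n with _ | _ | n
  · rw [toepOp_zero, shiftOp_zero, shiftOp_zero, map_zero]
  · rw [toepOp_succ, shiftOp_succ, shiftOp_succ, shiftOp_zero, map_zero, add_zero, toepOp_zero]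
  · simp only [toepOp_succ, shiftOp_succ]

/-- Reading off the zeroth coordinate sets `z = 0` in the symbols `A + z A*` and `z`. -/
lemma polyOp_apply_eq_toep (p : MvPolynomial (Fin 2) ℂ) (A : E →L[ℂ] E) (x : E) :
    polyOp p A 0 x = polyOp p (toepOp A) shiftOp (headOp x) 0 := by
  let W : ell2 E →ₗ[ℂ] E :=
    { toFun := fun y => y 0, map_add' := fun _ _ => rfl, map_smul' := fun _ _ => rfl }
  have := polyOp_intertwine p W (S := toepOp A) (P := shiftOp) (S' := A) (P' := 0)
    (fun y => toepOp_zero A y) (fun y => shiftOp_zero y) (headOp x)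
  refine Eq.trans ?_ this.symm
  change _ = polyOp p A 0 (headOp x 0)
  rw [headOp_zero]

lemma norm_polyOp_le_toep (p : MvPolynomial (Fin 2) ℂ) (A : E →L[ℂ] E) :
    ‖polyOp p A 0‖ ≤ ‖polyOp p (toepOp A) shiftOp‖ := by
  refine ContinuousLinearMap.opNorm_le_bound _ (norm_nonneg _) fun x => ?_
  rw [polyOp_apply_eq_toep, ← norm_headOp x]
  exact (lp.norm_apply_le_norm (by norm_num) _ 0).trans (ContinuousLinearMap.le_opNorm _ _)

end Toeplitz

/-! ### The dilation restricted to `ℓ²(𝒟_P)` -/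

section Dilation

variable {H : Type*} [NormedAddCommGroup H] [InnerProductSpace ℂ H] [CompleteSpace H]

/-- The embedding `y ↦ (0, y)` of `ℓ²(𝒟_P)` into the dilation space. -/
def tailEmb (P : H →L[ℂ] H) : ell2 (defectSpace P) →ₗ[ℂ] dilSpace P where
  toFun y := WithLp.toLp 2 (0, y)
  map_add' y z := by rw [← WithLp.toLp_add, Prod.mk_add_mk, add_zero]
  map_smul' c y := by rw [RingHom.id_apply, ← WithLp.toLp_smul, Prod.smul_mk, smul_zero]

lemma norm_tailEmb (P : H →L[ℂ] H) (y : ell2 (defectSpace P)) : ‖tailEmb P y‖ = ‖y‖ := by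
  have := WithLp.prod_norm_sq_eq_of_L2 (tailEmb P y)
  refine (pow_left_inj₀ (norm_nonneg _) (norm_nonneg _) two_ne_zero).1 ?_
  rw [this]
  simp [tailEmb]

lemma dilSpace_ext {P : H →L[ℂ] H} {x y : dilSpace P} (h1 : x.fst = y.fst)
    (h2 : ∀ n, x.snd n = y.snd n) : x = y := by
  refine WithLp.ofLp_injective 2 (Prod.ext h1 ?_)
  exact lp.ext (funext h2)

lemma tailEmb_toepOp (S P : H →L[ℂ] H) (A : defectSpace P →L[ℂ] defectSpace P)
    (y : ell2 (defectSpace P)) : tailEmb P (toepOp A y) = dilT S P A (tailEmb P y) := by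
  refine dilSpace_ext ?_ fun n => ?_
  · rw [dilT_fst]; exact (map_zero S).symm
  · cases n with
    | zero =>
      rw [dilT_snd_zero]
      change toepOp A y 0 = star A (defectMap P 0) + A (y 0)
      rw [toepOp_zero, map_zero, map_zero, zero_add]
    | succ n =>
      rw [dilT_snd_succ]
      change toepOp A y (n + 1) = star A (y n) + A (y (n + 1))
      exact add_comm _ _

lemma tailEmb_shiftOp (P : H →L[ℂ] H) (y : ell2 (defectSpace P)) :
    tailEmb P (shiftOp y) = dilV P (tailEmb P y) := by
  refine dilSpace_ext ?_ fun n => ?_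
  · rw [dilV_fst]; exact (map_zero P).symm
  · cases n with
    | zero =>
      rw [dilV_snd_zero]
      change shiftOp y 0 = defectMap P 0
      rw [shiftOp_zero, map_zero]
    | succ n =>
      rw [dilV_snd_succ]
      exact shiftOp_succ y n

lemma tailEmb_polyOp (p : MvPolynomial (Fin 2) ℂ) (S P : H →L[ℂ] H)
    (A : defectSpace P →L[ℂ] defectSpace P) (y : ell2 (defectSpace P)) :
    tailEmb P (polyOp p (toepOp A) shiftOp y) =
      polyOp p (dilT S P A) (dilV P) (tailEmb P y) :=
  polyOp_intertwine p (tailEmb P) (tailEmb_toepOp S P A) (tailEmb_shiftOp P) y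

lemma norm_polyOp_toep_le_dil (p : MvPolynomial (Fin 2) ℂ) (S P : H →L[ℂ] H)
    (A : defectSpace P →L[ℂ] defectSpace P) :
    ‖polyOp p (toepOp A) shiftOp‖ ≤ ‖polyOp p (dilT S P A) (dilV P)‖ := by
  refine ContinuousLinearMap.opNorm_le_bound _ (norm_nonneg _) fun y => ?_
  rw [← norm_tailEmb, tailEmb_polyOp p S, ← norm_tailEmb P y]
  exact ContinuousLinearMap.le_opNorm _ _

lemma IsGammaDistinguished.of_dilation {S P : H →L[ℂ] H}
    {A : defectSpace P →L[ℂ] defectSpace P}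
    (h : IsGammaDistinguished (dilT S P A) (dilV P)) : IsGammaDistinguished A 0 := by
  obtain ⟨hc, q, hq, hq0⟩ := h
  have hle : ∀ p, ‖polyOp p A 0‖ ≤ ‖polyOp p (dilT S P A) (dilV P)‖ := fun p =>
    (norm_polyOp_le_toep p A).trans (norm_polyOp_toep_le_dil p S P A)
  refine ⟨isGammaContraction_iff.2 ⟨Commute.zero_right A, fun p => ?_⟩, q, hq, ?_⟩
  · exact (hle p).trans ((isGammaContraction_iff.1 hc).2 p)
  · have := hle q
    rw [hq0, norm_zero] at this
    exact norm_le_zero_iff.1 this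

/-- The projection of the dilation space onto `H`. -/
def dilFst (P : H →L[ℂ] H) : dilSpace P →ₗ[ℂ] H where
  toFun x := x.fst
  map_add' _ _ := rfl
  map_smul' _ _ := rfl

lemma polyOp_dil_fst (p : MvPolynomial (Fin 2) ℂ) (S P : H →L[ℂ] H)
    (A : defectSpace P →L[ℂ] defectSpace P) (x : dilSpace P) :
    (polyOp p (dilT S P A) (dilV P) x).fst = polyOp p S P x.fst :=
  polyOp_intertwine p (dilFst P) (dilT_fst S P A) (dilV_fst P) x

end Dilation

/-! ### Hyponormal and normal operators -/

section Normal

variable {E : Type*} [NormedAddCommGroup E] [InnerProductSpace ℂ E] [CompleteSpace E]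

lemma commute_aeval {R : Type*} [Ring R] [Algebra ℂ R] {a b : R} (h : Commute a b)
    (f : Polynomial ℂ) : Commute (Polynomial.aeval a f) b := by
  induction f using Polynomial.induction_on' with
  | add p q hp hq => rw [map_add]; exact hp.add_left hq
  | monomial n c =>
    rw [Polynomial.aeval_monomial]
    exact (show Commute _ _ from Algebra.commutes c b).mul_left (h.pow_left n)

lemma isStarNormal_aeval {R : Type*} [Ring R] [StarRing R] [Algebra ℂ R] {a : R}
    [h : IsStarNormal a] (f : Polynomial ℂ) : IsStarNormal (Polynomial.aeval a f) := by
  have h1 : Commute (Polynomial.aeval a f) (star a) := commute_aeval h.star_comm_self.symm f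
  have h2 : Commute a (star (Polynomial.aeval a f)) := by
    have := h1.star_star
    rw [star_star] at this
    exact this.symm
  exact ⟨(commute_aeval h2 f).symm⟩

lemma inner_star_mul_self (T : E →L[ℂ] E) (x : E) :
    inner ℂ ((star T * T) x) x = ((‖T x‖ ^ 2 : ℝ) : ℂ) := by
  rw [mul_apply_eq_comp, ContinuousLinearMap.star_eq_adjoint,
    ContinuousLinearMap.adjoint_inner_left, inner_self_eq_norm_sq_to_K]
  norm_cast

lemma IsHyponormal.norm_star_le {T : E →L[ℂ] E} (h : IsHyponormal T) (x : E) :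
    ‖star T x‖ ≤ ‖T x‖ := by
  have h1 := h.re_inner_nonneg_left x
  rw [sub_apply, inner_sub_left, inner_star_mul_self] at h1
  have h2 := inner_star_mul_self (star T) x
  rw [star_star] at h2
  rw [h2, map_sub] at h1
  simp only [RCLike.re_to_complex, Complex.ofReal_re] at h1
  exact le_of_sq_le_sq (by linarith) (norm_nonneg _)

lemma IsHyponormal.sub_smul {T : E →L[ℂ] E} (h : IsHyponormal T) (l : ℂ) :
    IsHyponormal (T - l • 1) := by
  unfold IsHyponormal at h ⊢
  convert h using 1
  simp only [star_sub, star_smul, star_one, sub_mul, mul_sub, smul_mul_assoc, mul_smul_comm,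
    one_mul, mul_one, smul_sub]
  rw [smul_comm l (star l)]
  abel

/-- `‖T* T x‖ ≤ ‖T T x‖ = 0`, hence `‖T x‖² = ⟨T* T x, x⟩ = 0`: a hyponormal operator has no
nontrivial Jordan blocks. -/
lemma IsHyponormal.apply_eq_zero_of_apply_apply {T : E →L[ℂ] E} (h : IsHyponormal T) {x : E}
    (hx : T (T x) = 0) : T x = 0 := by
  have h1 : star T (T x) = 0 := by
    have := h.norm_star_le (T x)
    rw [hx, norm_zero] at this
    exact norm_le_zero_iff.1 this
  have h2 := inner_star_mul_self T x
  rw [mul_apply_eq_comp, h1, inner_zero_left] at h2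
  have h3 : ‖T x‖ ^ 2 = 0 := by exact_mod_cast h2.symm
  exact norm_eq_zero.1 (pow_eq_zero_iff two_ne_zero |>.1 h3)

lemma IsHyponormal.apply_eq_zero_of_pow {T : E →L[ℂ] E} (h : IsHyponormal T) (n : ℕ) {x : E}
    (hx : (T ^ n) x = 0) : T x = 0 := by
  induction n with
  | zero =>
    have : x = 0 := hx
    rw [this, map_zero]
  | succ n ih =>
    cases n with
    | zero => simpa using hx
    | succ n =>
      apply ih
      have e : (T ^ (n + 1 + 1)) x = T (T ((T ^ n) x)) := by
        rw [pow_succ', pow_succ']; rfl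
      rw [e] at hx
      rw [pow_succ']
      exact h.apply_eq_zero_of_apply_apply hx

/-- An eigenvector of `T` for `l` is an eigenvector of `T*` for `l̄`, because `T - l` is again
hyponormal. -/
lemma IsHyponormal.selfCommutator_apply_eq_zero {T : E →L[ℂ] E} (h : IsHyponormal T) {l : ℂ}
    {x : E} (hx : (T - l • 1) x = 0) : (star T * T - T * star T) x = 0 := by
  have h1 : star (T - l • 1) x = 0 := by
    have := (h.sub_smul l).norm_star_le x
    rw [hx, norm_zero] at this
    exact norm_le_zero_iff.1 this
  have e1 : T x = l • x := sub_eq_zero.1 hx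
  have e2 : star T x = star l • x := by
    rw [star_sub, star_smul, star_one] at h1
    exact sub_eq_zero.1 h1
  rw [sub_apply, mul_apply_eq_comp, mul_apply_eq_comp, e1, e2, map_smul, map_smul, e1, e2,
    smul_comm, sub_self]

/-- A hyponormal operator is normal on the kernel of any nonzero polynomial in it. -/
lemma IsHyponormal.selfCommutator_eq_zero_of_aeval {T : E →L[ℂ] E} (h : IsHyponormal T)
    (f : Polynomial ℂ) : f ≠ 0 → ∀ x, Polynomial.aeval T f x = 0 →
      (star T * T - T * star T) x = 0 := by
  induction f using UniqueFactorizationMonoid.induction_on_coprime with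
  | h0 => exact fun h => absurd rfl h
  | h1 hu =>
    intro _ x hx
    obtain ⟨c, hc, rfl⟩ := Polynomial.isUnit_iff.1 hu
    rw [Polynomial.aeval_C, Algebra.algebraMap_eq_smul_one] at hx
    have : x = 0 := (smul_eq_zero.1 hx).resolve_left hc.ne_zero
    rw [this, map_zero]
  | @hpr p i hp =>
    intro _ x hx
    obtain ⟨l, hl⟩ := Polynomial.exists_root_of_degree_eq_one
      (IsAlgClosed.degree_eq_one_of_irreducible ℂ hp.irreducible)
    obtain ⟨u, hu⟩ := (Polynomial.irreducible_X_sub_C l).associated_of_dvd hp.irreducible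
      (Polynomial.dvd_iff_isRoot.2 hl)
    -- Over `ℂ` a prime is a unit times `X - l`, so `x` is a generalized eigenvector, and by
    -- hyponormality an eigenvector.
    have e : Polynomial.aeval T ((Polynomial.X - Polynomial.C l) ^ i) x = 0 := by
      have : (Polynomial.X - Polynomial.C l) ^ i = (↑(u⁻¹) : Polynomial ℂ) ^ i * p ^ i := by
        rw [← hu, ← mul_pow]
        congr 1
        rw [mul_comm, mul_assoc, Units.mul_inv, mul_one]
      rw [this, map_mul, mul_apply_eq_comp, hx, map_zero]
    rw [map_pow, map_sub, Polynomial.aeval_X, Polynomial.aeval_C,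
      Algebra.algebraMap_eq_smul_one] at e
    exact h.selfCommutator_apply_eq_zero ((h.sub_smul l).apply_eq_zero_of_pow i e)
  | @hcp p q hpq ihp ihq =>
    intro h0 x hx
    obtain ⟨hp0, hq0⟩ := mul_ne_zero_iff.1 h0
    obtain ⟨a, b, hab⟩ := hpq.isCoprime
    -- The Bézout identity splits `x` into a vector killed by `q(T)` and one killed by `p(T)`.
    have ex : x = Polynomial.aeval T (a * p) x + Polynomial.aeval T (b * q) x := by
      rw [← add_apply, ← map_add, hab, map_one, one_apply_eq_self]
    rw [ex, map_add, ihq hq0, ihp hp0, add_zero]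
    · rw [← mul_apply_eq_comp, ← map_mul, show p * (b * q) = b * (p * q) by ring, map_mul,
        mul_apply_eq_comp, hx, map_zero]
    · rw [← mul_apply_eq_comp, ← map_mul, show q * (a * p) = a * (p * q) by ring, map_mul,
        mul_apply_eq_comp, hx, map_zero]

lemma IsHyponormal.isStarNormal_of_aeval_eq_zero {T : E →L[ℂ] E} (h : IsHyponormal T)
    {f : Polynomial ℂ} (hf : f ≠ 0) (hT : Polynomial.aeval T f = 0) : IsStarNormal T := by
  refine ⟨sub_eq_zero.1 (ContinuousLinearMap.ext fun x => ?_)⟩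
  exact h.selfCommutator_eq_zero_of_aeval f hf x (by rw [hT]; rfl)

/-! ### Algebraic operators -/

/-- Substituting a scalar for the second variable. -/
def substSnd (w : ℂ) (p : MvPolynomial (Fin 2) ℂ) : Polynomial ℂ :=
  MvPolynomial.aeval ![Polynomial.X, Polynomial.C w] p

-- Used with `w = 0` for the pair `(A, 0)` and with `|w| = 1` for the symbol at a point of the
-- circle.
omit [CompleteSpace E] in
lemma polyOp_smul_one (p : MvPolynomial (Fin 2) ℂ) (A : E →L[ℂ] E) (w : ℂ) :
    polyOp p A (w • 1) = Polynomial.aeval A (substSnd w p) := by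
  obtain ⟨φ, hφ, h0, h1⟩ := exists_polyOp_algHom ((Commute.one_right A).smul_right w)
  rw [← hφ]
  have : φ = (Polynomial.aeval A).comp
      (MvPolynomial.aeval ![Polynomial.X, Polynomial.C w]) := by
    refine MvPolynomial.algHom_ext fun i => ?_
    fin_cases i
    · simp [h0]
    · simp [h1, Algebra.algebraMap_eq_smul_one]
  rw [this]; rfl

lemma eval_substSnd (p : MvPolynomial (Fin 2) ℂ) (w l : ℂ) :
    (substSnd w p).eval l = evalPt p (l, w) := by
  have : (Polynomial.aeval l).comp (MvPolynomial.aeval ![Polynomial.X, Polynomial.C w]) =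
      MvPolynomial.aeval (R := ℂ) ![l, w] := by
    refine MvPolynomial.algHom_ext fun i => ?_
    fin_cases i <;> simp
  have := DFunLike.congr_fun this p
  simpa [substSnd, evalPt, MvPolynomial.aeval_eq_eval, Polynomial.coe_aeval_eq_eval] using this

/-- A spectral value `l` of `A` gives `(l, 0)` in the Taylor spectrum, hence in `Γ`, so `|l| ≤ 1`;
for normal operators the norm is the spectral radius. -/
lemma norm_le_one_of_isStarNormal {A : E →L[ℂ] E} [IsStarNormal A]
    (h : IsGammaContraction A 0) : ‖A‖ ≤ 1 := by
  have hr : spectralRadius ℂ A ≤ 1 := by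
    refine iSup₂_le fun l hl => ?_
    have hmem : (l, (0 : ℂ)) ∈ Gam := by
      refine h.2.1 fun hK => ?_
      obtain ⟨h1, -, h3⟩ := hK
      refine (spectrum.mem_iff.1 hl) ?_
      rw [← neg_sub, Algebra.algebraMap_eq_smul_one]
      refine IsUnit.neg ?_
      rw [ContinuousLinearMap.isUnit_iff_bijective]
      constructor
      · refine (injective_iff_map_eq_zero _).2 fun x hx => h1 x hx ?_
        simp
      · intro w
        obtain ⟨x, y, hxy⟩ := h3 w
        exact ⟨y, by simpa using hxy⟩
    have := (symPt_mem_Gam (z := l) (w := 0)).1 (by simpa [symPt] using hmem)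
    have h2 : ‖l‖₊ ≤ 1 := this.1
    exact_mod_cast h2
  rw [IsStarNormal.spectralRadius_eq_nnnorm] at hr
  exact_mod_cast hr

lemma isUnit_aeval_X_sub_C {A : E →L[ℂ] E} (hA : ‖A‖ ≤ 1) {l : ℂ} (hl : 1 < ‖l‖) :
    IsUnit (Polynomial.aeval A (Polynomial.X - Polynomial.C l)) := by
  have hlt : ‖A‖ * ‖(1 : E →L[ℂ] E)‖ < ‖l‖ :=
    ((mul_le_of_le_one_right (norm_nonneg _) ContinuousLinearMap.norm_id_le).trans hA).trans_lt hl
  have := spectrum.mem_resolventSet_of_norm_lt_mul hlt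
  rw [spectrum.mem_resolventSet_iff] at this
  rw [map_sub, Polynomial.aeval_X, Polynomial.aeval_C, ← neg_sub]
  exact this.neg

/-- The monic polynomial with the given roots. -/
def rootPoly (s : Multiset ℂ) : Polynomial ℂ :=
  (s.map fun l => Polynomial.X - Polynomial.C l).prod

lemma isUnit_aeval_rootPoly {A : E →L[ℂ] E} (hA : ‖A‖ ≤ 1) (s : Multiset ℂ)
    (hs : ∀ l ∈ s, 1 < ‖l‖) : IsUnit (Polynomial.aeval A (rootPoly s)) := by
  induction s using Multiset.induction_on with
  | empty => simp [rootPoly]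
  | cons l s ih =>
    rw [rootPoly, Multiset.map_cons, Multiset.prod_cons, map_mul]
    exact (isUnit_aeval_X_sub_C hA (hs l (Multiset.mem_cons_self l s))).mul
      (ih fun m hm => hs m (Multiset.mem_cons_of_mem hm))

/-- No root lies on the circle, and the factors with roots outside the closed disc are invertible at
`A` and can be cancelled. -/
lemma exists_rootPoly_eq_zero {A : E →L[ℂ] E} (hA : ‖A‖ ≤ 1) {f : Polynomial ℂ} (hf : f ≠ 0)
    (hf1 : ∀ l : ℂ, ‖l‖ = 1 → f.eval l ≠ 0) (hA0 : Polynomial.aeval A f = 0) :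
    ∃ s : Multiset ℂ, (∀ l ∈ s, ‖l‖ < 1) ∧ Polynomial.aeval A (rootPoly s) = 0 := by
  classical
  refine ⟨f.roots.filter fun l => ‖l‖ < 1, fun l hl => (Multiset.mem_filter.1 hl).2, ?_⟩
  have e : f = Polynomial.C f.leadingCoeff * (rootPoly (f.roots.filter fun l => ‖l‖ < 1) *
      rootPoly (f.roots.filter fun l => ¬ ‖l‖ < 1)) := by
    rw [rootPoly, rootPoly, ← Multiset.prod_add, ← Multiset.map_add, Multiset.filter_add_not]
    exact (IsAlgClosed.splits f).eq_prod_roots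
  have hu : IsUnit (Polynomial.aeval A (rootPoly (f.roots.filter fun l => ¬ ‖l‖ < 1))) := by
    refine isUnit_aeval_rootPoly hA _ fun l hl => ?_
    obtain ⟨hl1, hl2⟩ := Multiset.mem_filter.1 hl
    refine lt_of_le_of_ne (not_lt.1 hl2) fun h => hf1 l h.symm ?_
    exact (Polynomial.mem_roots'.1 hl1).2
  rw [e, map_mul, Polynomial.aeval_C, Algebra.algebraMap_eq_smul_one, smul_mul_assoc, one_mul,
    map_mul] at hA0
  have h0 := (smul_eq_zero.1 hA0).resolve_left (Polynomial.leadingCoeff_ne_zero.2 hf)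
  exact (hu.mul_left_eq_zero).1 h0

lemma IsStarNormal.star_apply_eq_zero {T : E →L[ℂ] E} [h : IsStarNormal T] {x : E}
    (hx : T x = 0) : star T x = 0 := by
  have h1 : IsHyponormal T := by
    unfold IsHyponormal
    rw [h.star_comm_self.eq, sub_self]
    exact ContinuousLinearMap.isPositive_zero
  have := h1.norm_star_le x
  rw [hx, norm_zero] at this
  exact norm_le_zero_iff.1 this

/-! ### Annihilating the Toeplitz pair of a normal operator. -/

/-- The product of the polynomials `s - λ - λ̄ p` over a multiset of `λ`s. -/
def linPolyProd (s : Multiset ℂ) : MvPolynomial (Fin 2) ℂ := (s.map linPoly).prod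

lemma IsGammaDistinguishedPoly.linPolyProd_mul {q : MvPolynomial (Fin 2) ℂ}
    (hq : IsGammaDistinguishedPoly q) (s : Multiset ℂ) (hs : ∀ l ∈ s, ‖l‖ < 1) :
    IsGammaDistinguishedPoly (linPolyProd s * q) := by
  induction s using Multiset.induction_on with
  | empty => simpa [linPolyProd] using hq
  | cons l s ih =>
    rw [linPolyProd, Multiset.map_cons, Multiset.prod_cons, mul_assoc]
    exact (ih fun m hm => hs m (Multiset.mem_cons_of_mem hm)).mul_linPoly
      (hs l (Multiset.mem_cons_self l s))

/-- The factor for `l` acts as the Toeplitz operator with symbol `(A - l) + z (A - l)*`. Applied to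
a sequence with entries in the kernel of `(A - l) G`, it produces entries in the kernel of `G`, so
each factor strips off one root. -/
lemma polyOp_linPolyProd_toep_apply (A : E →L[ℂ] E) [hn : IsStarNormal A] (s : Multiset ℂ) :
    ∀ y : ell2 E, (∀ n, Polynomial.aeval A (rootPoly s) (y n) = 0) →
      polyOp (linPolyProd s) (toepOp A) shiftOp y = 0 := by
  have hc := commute_toepOp_shiftOp A
  induction s using Multiset.induction_on with
  | empty =>
    intro y hy
    have : y = 0 := by
      ext n
      simpa [rootPoly] using hy n
    rw [this, map_zero]
  | cons l s ih =>
    intro y hy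
    rw [linPolyProd, Multiset.map_cons, Multiset.prod_cons, mul_comm, polyOp_mul hc,
      mul_apply_eq_comp]
    refine ih _ ?_
    set G := Polynomial.aeval A (rootPoly s) with hG
    have hAl : Polynomial.aeval A (Polynomial.X - Polynomial.C l) = A - l • 1 := by
      rw [map_sub, Polynomial.aeval_X, Polynomial.aeval_C, Algebra.algebraMap_eq_smul_one]
    have : IsStarNormal (A - l • (1 : E →L[ℂ] E)) := by
      rw [← hAl]; exact isStarNormal_aeval _
    have hy1 : ∀ n, (A - l • (1 : E →L[ℂ] E)) (G (y n)) = 0 := fun n => by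
      have := hy n
      rwa [rootPoly, Multiset.map_cons, Multiset.prod_cons, map_mul, hAl] at this
    have hy2 : ∀ n, G ((A - l • (1 : E →L[ℂ] E)) (y n)) = 0 := fun n => by
      rw [← hy1 n, ← mul_apply_eq_comp, ← mul_apply_eq_comp, ← hAl, hG, ← map_mul, ← map_mul,
        mul_comm]
    -- `G` commutes with `(A - l)*`, and `G (y n)` lies in the kernel of the normal operator `A -
    -- l`, hence in that of its adjoint.
    have hy3 : ∀ n, G (star (A - l • (1 : E →L[ℂ] E)) (y n)) = 0 := fun n => by
      have hcomm : Commute G (star (A - l • (1 : E →L[ℂ] E))) := by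
        refine commute_aeval ?_ _
        rw [star_sub, star_smul, star_one]
        exact (hn.star_comm_self.symm).sub_right ((Commute.one_right A).smul_right _)
      rw [← mul_apply_eq_comp, hcomm.eq, mul_apply_eq_comp]
      exact IsStarNormal.star_apply_eq_zero (hy1 n)
    intro n
    rw [polyOp_linPoly hc]
    cases n with
    | zero =>
      have e : ((toepOp A - l • 1 - starRingEnd ℂ l • shiftOp : ell2 E →L[ℂ] ell2 E) y) 0 =
          (A - l • (1 : E →L[ℂ] E)) (y 0) := by
        change toepOp A y 0 - l • y 0 - starRingEnd ℂ l • shiftOp y 0 = A (y 0) - l • y 0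
        rw [toepOp_zero, shiftOp_zero, smul_zero, sub_zero]
      rw [e, hy2]
    | succ n =>
      have e : ((toepOp A - l • 1 - starRingEnd ℂ l • shiftOp : ell2 E →L[ℂ] ell2 E) y) (n + 1) =
          (A - l • (1 : E →L[ℂ] E)) (y (n + 1)) + star (A - l • (1 : E →L[ℂ] E)) (y n) := by
        rw [star_sub, star_smul, star_one]
        change toepOp A y (n + 1) - l • y (n + 1) - starRingEnd ℂ l • shiftOp y (n + 1) =
          (A (y (n + 1)) - l • y (n + 1)) + (star A (y n) - starRingEnd ℂ l • y n)
        rw [toepOp_succ, shiftOp_succ]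
        abel
      rw [e, map_add, hy2, hy3, add_zero]

lemma polyOp_linPolyProd_toep (A : E →L[ℂ] E) [IsStarNormal A] {s : Multiset ℂ}
    (hs : Polynomial.aeval A (rootPoly s) = 0) :
    polyOp (linPolyProd s) (toepOp A) shiftOp = 0 :=
  ContinuousLinearMap.ext fun y =>
    polyOp_linPolyProd_toep_apply A s y fun n => by rw [hs]; rfl

end Normal

/-! ### Norm estimates for the Toeplitz pair -/

section ToeplitzNorm

variable {E : Type*} [NormedAddCommGroup E] [InnerProductSpace ℂ E] [CompleteSpace E]

/-- The roots are `c (t/2 ± i r)` with `r² = 1 - (t/2)²`, both unimodular. -/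
lemma mem_Gam_of_real {c w : ℂ} (hc : ‖c‖ = 1) (hw : c ^ 2 = w) {t : ℝ} (ht : |t| ≤ 2) :
    (c * t, w) ∈ Gam := by
  set r := Real.sqrt (1 - (t / 2) ^ 2) with hr
  have hrr : r ^ 2 = 1 - (t / 2) ^ 2 := by
    refine Real.sq_sqrt ?_
    nlinarith [sq_abs t, abs_nonneg t]
  have hrc : (r : ℂ) ^ 2 = 1 - (t / 2) ^ 2 := by exact_mod_cast congrArg (fun x : ℝ => (x : ℂ)) hrr
  have hn : ∀ u : ℝ, u ^ 2 = r ^ 2 → ‖c * ((t / 2 : ℝ) + u * Complex.I)‖ ≤ 1 := by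
    intro u hu
    rw [norm_mul, hc, one_mul]
    refine le_of_sq_le_sq ?_ zero_le_one
    rw [← Complex.normSq_eq_norm_sq, Complex.normSq_add_mul_I, hu, hrr]
    norm_num
  have e : (c * t, w) = symPt (c * ((t / 2 : ℝ) + r * Complex.I))
      (c * ((t / 2 : ℝ) + (-r : ℝ) * Complex.I)) := by
    refine Prod.ext ?_ ?_
    · simp only [symPt]; push_cast; ring
    · simp only [symPt]; push_cast
      rw [← hw]
      linear_combination (-c ^ 2) * hrc + c ^ 2 * (r : ℂ) ^ 2 * Complex.I_sq
  rw [e, symPt_mem_Gam]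
  exact ⟨hn r rfl, hn (-r) (neg_sq r)⟩

lemma norm_aeval_le_of_isSelfAdjoint {K : E →L[ℂ] E} (hK : IsSelfAdjoint K) (f : Polynomial ℂ)
    {M : ℝ} (hM0 : 0 ≤ M) (hM : ∀ t : ℝ, |t| ≤ ‖K‖ → ‖f.eval (t : ℂ)‖ ≤ M) :
    ‖Polynomial.aeval K f‖ ≤ M := by
  rcases subsingleton_or_nontrivial E with hE | hE
  · rw [Subsingleton.elim (Polynomial.aeval K f) 0, norm_zero]; exact hM0
  have : IsStarNormal K := hK.isStarNormal
  have := isStarNormal_aeval (a := K) f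
  lift M to NNReal using hM0
  have hr : spectralRadius ℂ (Polynomial.aeval K f) ≤ M := by
    refine iSup₂_le fun l hl => ?_
    rw [spectrum.map_polynomial_aeval_of_nonempty K f (spectrum.nonempty K)] at hl
    obtain ⟨t, ht, rfl⟩ := hl
    have h1 : ‖t‖ ≤ ‖K‖ := spectrum.norm_le_norm_of_mem ht
    have h2 := hK.mem_spectrum_eq_re ht
    have h3 := hM t.re (by rw [h2, Complex.norm_real] at h1; exact h1)
    rw [← h2] at h3
    exact_mod_cast h3
  rw [IsStarNormal.spectralRadius_eq_nnnorm] at hr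
  exact_mod_cast hr

/-- With `c² = w`, the symbol `A + w A*` equals `c K` for the self-adjoint `K = c̄ A + c A*` with
`‖K‖ ≤ 2`, and the points `(c t, w)` with `|t| ≤ 2` lie in `Γ`. -/
lemma norm_polyOp_symbol_le {A : E →L[ℂ] E} (hA : ‖A‖ ≤ 1) {w : ℂ} (hw : ‖w‖ = 1)
    (p : MvPolynomial (Fin 2) ℂ) :
    ‖polyOp p (A + w • star A) (w • 1)‖ ≤ sSup ((fun y => ‖evalPt p y‖) '' Gam) := by
  obtain ⟨c, hc⟩ := IsAlgClosed.exists_pow_nat_eq w (n := 2) (by norm_num)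
  have hc1 : ‖c‖ = 1 := by
    have : ‖c‖ ^ 2 = 1 := by rw [← norm_pow, hc, hw]
    exact (pow_eq_one_iff_of_nonneg (norm_nonneg c) two_ne_zero).1 this
  have hcc : c * star c = 1 := by
    change c * starRingEnd ℂ c = 1
    rw [Complex.mul_conj, Complex.normSq_eq_norm_sq, hc1]; simp
  set K := star c • A + c • star A with hKdef
  have hK : IsSelfAdjoint K := by
    rw [IsSelfAdjoint, hKdef, star_add, star_smul, star_smul, star_star, star_star, add_comm]
  have hKn : ‖K‖ ≤ 2 := by
    refine (norm_add_le _ _).trans ?_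
    rw [norm_smul, norm_smul, norm_star, norm_star, hc1]
    linarith
  have hN : A + w • star A = Polynomial.aeval K (Polynomial.C c * Polynomial.X) := by
    rw [map_mul, Polynomial.aeval_C, Polynomial.aeval_X, Algebra.algebraMap_eq_smul_one,
      smul_mul_assoc, one_mul, hKdef, smul_add, smul_smul, smul_smul, hcc, one_smul, ← sq, hc]
  rw [polyOp_smul_one, hN, ← Polynomial.aeval_comp]
  obtain ⟨x, hx⟩ := Gam_nonempty
  refine norm_aeval_le_of_isSelfAdjoint hK _ ((norm_nonneg _).trans (evalPt_le_sSup p hx))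
    fun t ht => ?_
  rw [Polynomial.eval_comp, Polynomial.eval_mul, Polynomial.eval_C, Polynomial.eval_X,
    eval_substSnd]
  exact evalPt_le_sSup p (mem_Gam_of_real hc1 hc (ht.trans hKn))

omit [CompleteSpace E] in
/-- Parseval's identity for the discrete Fourier transform of a vector-valued sequence. -/
lemma sum_norm_sq_discreteFourier {N : ℕ} (hN : N ≠ 0) {w : ℂ} (hw : IsPrimitiveRoot w N)
    (c : ℕ → E) :
    ∑ j ∈ Finset.range N, ‖∑ k ∈ Finset.range N, (w ^ j) ^ k • c k‖ ^ 2 =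
      N * ∑ k ∈ Finset.range N, ‖c k‖ ^ 2 := by
  have hw1 : ‖w‖ = 1 := hw.norm'_eq_one hN
  have hww : starRingEnd ℂ w * w = 1 := by
    rw [mul_comm, Complex.mul_conj, Complex.normSq_eq_norm_sq, hw1]; simp
  have hgeom : ∀ k ∈ Finset.range N, ∀ l ∈ Finset.range N,
      ∑ j ∈ Finset.range N, (starRingEnd ℂ ((w ^ j) ^ k) * (w ^ j) ^ l) =
        if l = k then (N : ℂ) else 0 := by
    intro k hk l hl
    have e : ∀ j, starRingEnd ℂ ((w ^ j) ^ k) * (w ^ j) ^ l =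
        (starRingEnd ℂ w ^ k * w ^ l) ^ j := by
      intro j; rw [map_pow, map_pow, mul_pow]; ring
    simp only [e]
    split_ifs with hkl
    · subst hkl
      rw [← mul_pow, hww]; simp
    · have hne : starRingEnd ℂ w ^ k * w ^ l ≠ 1 := by
        intro h
        apply hkl
        refine hw.pow_inj (Finset.mem_range.1 hl) (Finset.mem_range.1 hk) ?_
        calc w ^ l = (starRingEnd ℂ w * w) ^ k * w ^ l := by rw [hww]; simp
          _ = w ^ k * (starRingEnd ℂ w ^ k * w ^ l) := by rw [mul_pow]; ring
          _ = w ^ k := by rw [h, mul_one]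
      rw [geom_sum_eq hne]
      have : (starRingEnd ℂ w ^ k * w ^ l) ^ N = 1 := by
        rw [mul_pow, ← pow_mul, ← pow_mul, mul_comm k, mul_comm l, pow_mul, pow_mul, ← map_pow,
          hw.pow_eq_one]; simp
      rw [this, sub_self, zero_div]
  have key : ∀ j, (((‖∑ k ∈ Finset.range N, (w ^ j) ^ k • c k‖ ^ 2 : ℝ)) : ℂ) =
      ∑ k ∈ Finset.range N, ∑ l ∈ Finset.range N,
        (starRingEnd ℂ ((w ^ j) ^ k) * (w ^ j) ^ l) * inner ℂ (c k) (c l) := by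
    intro j
    have := inner_self_eq_norm_sq_to_K (𝕜 := ℂ) (∑ k ∈ Finset.range N, (w ^ j) ^ k • c k)
    rw [sum_inner] at this
    push_cast
    refine Eq.trans (by exact this.symm) (Finset.sum_congr rfl fun k _ => ?_)
    rw [inner_sum]
    refine Finset.sum_congr rfl fun l _ => ?_
    rw [inner_smul_left, inner_smul_right]; ring
  have hfin : ((∑ j ∈ Finset.range N, ‖∑ k ∈ Finset.range N, (w ^ j) ^ k • c k‖ ^ 2 : ℝ) : ℂ) =
      ((N * ∑ k ∈ Finset.range N, ‖c k‖ ^ 2 : ℝ) : ℂ) := by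
    rw [Complex.ofReal_sum]
    simp only [key]
    rw [Finset.sum_comm]
    push_cast
    rw [Finset.mul_sum]
    refine Finset.sum_congr rfl fun k hk => ?_
    rw [Finset.sum_comm]
    simp only [← Finset.sum_mul]
    rw [Finset.sum_congr rfl fun l hl => by rw [hgeom k hk l hl]]
    simp only [ite_mul, zero_mul]
    rw [Finset.sum_ite_eq' _ k, if_pos hk, inner_self_eq_norm_sq_to_K]
    rfl
  exact_mod_cast hfin

/-- Evaluation at `w` of the polynomial whose coefficients are the first `N` entries of `y`. -/
def evalSeq (N : ℕ) (w : ℂ) (y : ell2 E) : E := ∑ k ∈ Finset.range N, w ^ k • y k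

omit [InnerProductSpace ℂ E] [CompleteSpace E] in
lemma norm_sq_eq_sum_of_support {N : ℕ} {y : ell2 E} (hy : ∀ k, N ≤ k → y k = 0) :
    ‖y‖ ^ 2 = ∑ k ∈ Finset.range N, ‖y k‖ ^ 2 := by
  rw [ell2_norm_sq]
  refine tsum_eq_sum fun k hk => ?_
  rw [hy k (by simpa using hk)]
  simp

lemma toepOp_support {d : ℕ} {A : E →L[ℂ] E} {y : ell2 E} (hy : ∀ k, d ≤ k → y k = 0) :
    ∀ k, d + 1 ≤ k → toepOp A y k = 0 := by
  intro k hk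
  obtain ⟨k, rfl⟩ := Nat.exists_eq_succ_of_ne_zero (show k ≠ 0 by omega)
  rw [Nat.succ_eq_add_one, toepOp_succ, hy _ (by omega), hy _ (by omega), map_zero, map_zero,
    add_zero]

omit [CompleteSpace E] in
lemma shiftOp_support {d : ℕ} {y : ell2 E} (hy : ∀ k, d ≤ k → y k = 0) :
    ∀ k, d + 1 ≤ k → shiftOp y k = 0 := by
  intro k hk
  obtain ⟨k, rfl⟩ := Nat.exists_eq_succ_of_ne_zero (show k ≠ 0 by omega)
  rw [Nat.succ_eq_add_one, shiftOp_succ, hy _ (by omega)]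

-- The shift may move a nonzero entry to index `d`, so the truncation length must exceed `d`.
omit [CompleteSpace E] in
lemma evalSeq_shiftOp {d N : ℕ} {y : ell2 E} (hy : ∀ k, d ≤ k → y k = 0) (hN : d + 1 ≤ N)
    (w : ℂ) : evalSeq N w (shiftOp y) = w • evalSeq N w y := by
  obtain ⟨N, rfl⟩ := Nat.exists_eq_succ_of_ne_zero (show N ≠ 0 by omega)
  rw [evalSeq, evalSeq, Finset.sum_range_succ', Finset.sum_range_succ _ N, hy N (by omega)]
  simp only [shiftOp_zero, shiftOp_succ, smul_zero, add_zero, Finset.smul_sum, smul_smul, pow_succ']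

lemma evalSeq_toepOp {d N : ℕ} {A : E →L[ℂ] E} {y : ell2 E} (hy : ∀ k, d ≤ k → y k = 0)
    (hN : d + 1 ≤ N) (w : ℂ) :
    evalSeq N w (toepOp A y) = (A + w • star A) (evalSeq N w y) := by
  have e1 : evalSeq N w (toepOp A y) =
      evalSeq N w (diagOp A y) + evalSeq N w (shiftOp (diagOp (star A) y)) := by
    simp only [evalSeq, ← Finset.sum_add_distrib, ← smul_add]
    rfl
  have e2 : ∀ B : E →L[ℂ] E, evalSeq N w (diagOp B y) = B (evalSeq N w y) := by
    intro B
    simp only [evalSeq, diagOp_apply, map_sum, map_smul]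
  have hy' : ∀ k, d ≤ k → diagOp (star A) y k = 0 := fun k hk => by
    rw [diagOp_apply, hy k hk, map_zero]
  rw [e1, evalSeq_shiftOp hy' hN, e2, e2]
  rfl

/-- Evaluation at `w` replaces the Toeplitz pair by its symbol on finitely supported sequences. The
bound `d'` accounts for the growth of the support and does not depend on `y` or `w`. -/
lemma evalSeq_polyOp (A : E →L[ℂ] E) (p : MvPolynomial (Fin 2) ℂ) :
    ∀ d : ℕ, ∃ d' : ℕ, ∀ y : ell2 E, (∀ k, d ≤ k → y k = 0) →
      (∀ k, d' ≤ k → polyOp p (toepOp A) shiftOp y k = 0) ∧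
      ∀ N, d' ≤ N → ∀ w : ℂ, evalSeq N w (polyOp p (toepOp A) shiftOp y) =
        polyOp p (A + w • star A) (w • 1) (evalSeq N w y) := by
  have hc := commute_toepOp_shiftOp A
  have hc' : ∀ w : ℂ, Commute (A + w • star A) (w • (1 : E →L[ℂ] E)) := fun w =>
    (Commute.one_right _).smul_right w
  obtain ⟨φ, hφ, hφ0, hφ1⟩ := exists_polyOp_algHom hc
  choose ψ hψ hψ0 hψ1 using fun w => exists_polyOp_algHom (hc' w)
  simp only [← hφ, ← hψ]
  induction p using MvPolynomial.induction_on with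
  | C a =>
    intro d
    refine ⟨d, fun y hy => ⟨fun k hk => ?_, fun N hN w => ?_⟩⟩
    · rw [← MvPolynomial.algebraMap_eq, AlgHom.commutes, Algebra.algebraMap_eq_smul_one]
      change a • y k = 0
      rw [hy k hk, smul_zero]
    · rw [← MvPolynomial.algebraMap_eq, AlgHom.commutes, AlgHom.commutes,
        Algebra.algebraMap_eq_smul_one, Algebra.algebraMap_eq_smul_one]
      change ∑ k ∈ Finset.range N, w ^ k • (a • y k) = a • ∑ k ∈ Finset.range N, w ^ k • y k
      rw [Finset.smul_sum]
      exact Finset.sum_congr rfl fun k _ => smul_comm _ _ _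
  | add p q hp hq =>
    intro d
    obtain ⟨d₁, h₁⟩ := hp d
    obtain ⟨d₂, h₂⟩ := hq d
    refine ⟨max d₁ d₂, fun y hy => ⟨fun k hk => ?_, fun N hN w => ?_⟩⟩
    · rw [map_add]
      change φ p y k + φ q y k = 0
      rw [(h₁ y hy).1 k (le_of_max_le_left hk), (h₂ y hy).1 k (le_of_max_le_right hk), add_zero]
    · rw [map_add, map_add, add_apply, add_apply, ← (h₁ y hy).2 N (le_of_max_le_left hN),
        ← (h₂ y hy).2 N (le_of_max_le_right hN)]
      simp only [evalSeq, ← Finset.sum_add_distrib, ← smul_add]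
      rfl
  | mul_X p i hp =>
    intro d
    obtain ⟨d', h⟩ := hp (d + 1)
    refine ⟨max d' (d + 1), fun y hy => ?_⟩
    simp only [map_mul, mul_apply_eq_comp]
    fin_cases i
    · simp only [Fin.zero_eta, hφ0, hψ0]
      obtain ⟨h1, h2⟩ := h (toepOp A y) (toepOp_support hy)
      refine ⟨fun k hk => h1 k (le_of_max_le_left hk), fun N hN w => ?_⟩
      rw [h2 N (le_of_max_le_left hN), evalSeq_toepOp hy (le_of_max_le_right hN)]
    · simp only [Fin.mk_one, hφ1, hψ1]
      obtain ⟨h1, h2⟩ := h (shiftOp y) (shiftOp_support hy)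
      refine ⟨fun k hk => h1 k (le_of_max_le_left hk), fun N hN w => ?_⟩
      rw [h2 N (le_of_max_le_left hN), evalSeq_shiftOp hy (le_of_max_le_right hN)]
      rfl

/-- A finitely supported sequence is a vector polynomial; sampling at the `N`-th roots of unity is
isometric up to the factor `N`, and the symbol bound applies at each sample. -/
lemma norm_polyOp_toep_apply_le_of_support {A : E →L[ℂ] E} (hA : ‖A‖ ≤ 1)
    (p : MvPolynomial (Fin 2) ℂ) {d : ℕ} {y : ell2 E} (hy : ∀ k, d ≤ k → y k = 0) :
    ‖polyOp p (toepOp A) shiftOp y‖ ≤ sSup ((fun x => ‖evalPt p x‖) '' Gam) * ‖y‖ := by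
  set M := sSup ((fun x => ‖evalPt p x‖) '' Gam) with hM
  have hM0 : 0 ≤ M := by
    obtain ⟨x, hx⟩ := Gam_nonempty
    exact (norm_nonneg _).trans (evalPt_le_sSup p hx)
  obtain ⟨d', h⟩ := evalSeq_polyOp A p d
  obtain ⟨h1, h2⟩ := h y hy
  -- Long enough to see all of `y` and its image; the `1` keeps `N` nonzero.
  set N := max (max d d') 1 with hN
  have hN0 : N ≠ 0 := by omega
  have hw := Complex.isPrimitiveRoot_exp N hN0
  set w := Complex.exp (2 * Real.pi * Complex.I / N)
  refine le_of_sq_le_sq ?_ (mul_nonneg hM0 (norm_nonneg _))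
  have hNpos : (0 : ℝ) < N := by exact_mod_cast Nat.pos_of_ne_zero hN0
  refine le_of_mul_le_mul_left ?_ hNpos
  rw [mul_pow, norm_sq_eq_sum_of_support (N := N) fun k hk => h1 k (by omega),
    norm_sq_eq_sum_of_support (N := N) fun k hk => hy k (by omega),
    ← sum_norm_sq_discreteFourier hN0 hw, mul_left_comm, ← sum_norm_sq_discreteFourier hN0 hw,
    Finset.mul_sum]
  refine Finset.sum_le_sum fun j _ => ?_
  have e := h2 N (by omega) (w ^ j)
  simp only [evalSeq] at e
  rw [e, ← mul_pow]
  refine pow_le_pow_left₀ (norm_nonneg _) ((ContinuousLinearMap.le_opNorm _ _).trans ?_) 2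
  refine mul_le_mul_of_nonneg_right (norm_polyOp_symbol_le hA ?_ p) (norm_nonneg _)
  rw [norm_pow, hw.norm'_eq_one hN0, one_pow]

/-- The polynomial von Neumann inequality over `Γ` for the Toeplitz pair of a contraction. -/
lemma norm_polyOp_toep_apply_le {A : E →L[ℂ] E} (hA : ‖A‖ ≤ 1)
    (p : MvPolynomial (Fin 2) ℂ) (y : ell2 E) :
    ‖polyOp p (toepOp A) shiftOp y‖ ≤ sSup ((fun x => ‖evalPt p x‖) '' Gam) * ‖y‖ := by
  have hlim := (lp.hasSum_single (E := fun _ : ℕ => E) (p := 2) (by norm_num) y).tendsto_sum_nat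
  refine le_of_tendsto_of_tendsto' (((polyOp p (toepOp A) shiftOp).continuous.tendsto y).comp
    hlim).norm (hlim.norm.const_mul _) fun n => ?_
  refine norm_polyOp_toep_apply_le_of_support hA p (d := n) fun k hk => ?_
  rw [lp.coeFn_sum, Finset.sum_apply]
  refine Finset.sum_eq_zero fun i hi => ?_
  exact lp.single_apply_ne (E := fun _ : ℕ => E) 2 i _ (by
    have := Finset.mem_range.1 hi
    omega)

end ToeplitzNorm

/-! ### The defect operator -/

section Defect

variable {H : Type*} [NormedAddCommGroup H] [InnerProductSpace ℂ H] [CompleteSpace H]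

lemma defectOp_nonneg (P : H →L[ℂ] H) : 0 ≤ defectOp P := CFC.sqrt_nonneg _

lemma defectOp_mul_self {P : H →L[ℂ] H} (hP : ‖P‖ ≤ 1) :
    defectOp P * defectOp P = 1 - star P * P := by
  refine CFC.sqrt_mul_sqrt_self _ ?_
  rw [sub_nonneg]
  refine (CStarAlgebra.norm_le_one_iff_of_nonneg _ (star_mul_self_nonneg P)).1 ?_
  rw [CStarRing.norm_star_mul_self]
  exact mul_le_one₀ hP (norm_nonneg _) hP

lemma inner_defectOp (P : H →L[ℂ] H) (x y : H) :
    inner ℂ (defectOp P x) y = inner ℂ x (defectOp P y) := by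
  have h : star (defectOp P) = defectOp P := (IsSelfAdjoint.of_nonneg (defectOp_nonneg P)).star_eq
  conv_lhs => rw [← h]
  rw [ContinuousLinearMap.star_eq_adjoint, ContinuousLinearMap.adjoint_inner_left]

lemma inner_defectMap (P : H →L[ℂ] H) (w : defectSpace P) (y : H) :
    inner ℂ (defectOp P w) y = inner ℂ w (defectMap P y) :=
  inner_defectOp P w y

lemma norm_sq_defectMap {P : H →L[ℂ] H} (hP : ‖P‖ ≤ 1) (x : H) :
    ‖defectMap P x‖ ^ 2 = ‖x‖ ^ 2 - ‖P x‖ ^ 2 := by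
  have h : inner ℂ (defectOp P x) (defectOp P x) = inner ℂ x x - inner ℂ (P x) (P x) := by
    rw [inner_defectOp, ← mul_apply_eq_comp, defectOp_mul_self hP, sub_apply, inner_sub_right,
      mul_apply_eq_comp, one_apply_eq_self, ContinuousLinearMap.star_eq_adjoint,
      ContinuousLinearMap.adjoint_inner_right]
  simp only [inner_self_eq_norm_sq_to_K] at h
  change ‖defectOp P x‖ ^ 2 = _
  exact_mod_cast h

/-- The kernel of the self-adjoint `D_P` is orthogonal to its range, hence to `𝒟_P`. -/
lemma eq_zero_of_defectOp_eq_zero {P : H →L[ℂ] H} {w : defectSpace P}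
    (hw : defectOp P w = 0) : w = 0 := by
  have hle : defectSpace P ≤ (ℂ ∙ (w : H))ᗮ := by
    refine Submodule.topologicalClosure_minimal _ ?_ (Submodule.isClosed_orthogonal _)
    rintro _ ⟨z, rfl⟩
    rw [Submodule.mem_orthogonal_singleton_iff_inner_left]
    change inner ℂ (defectOp P z) (w : H) = 0
    rw [inner_defectOp, hw, inner_zero_right]
  have := Submodule.mem_orthogonal_singleton_iff_inner_left.1 (hle w.2)
  exact Subtype.ext (inner_self_eq_zero.1 this)

lemma IsFundamentalOperator.apply {S P : H →L[ℂ] H} {A : defectSpace P →L[ℂ] defectSpace P}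
    (hA : IsFundamentalOperator S P A) (x : H) :
    defectOp P (A (defectMap P x)) = S x - star S (P x) :=
  (DFunLike.congr_fun hA x).symm

lemma IsFundamentalOperator.star_apply {S P : H →L[ℂ] H}
    {A : defectSpace P →L[ℂ] defectSpace P} (hA : IsFundamentalOperator S P A) (y : H) :
    defectOp P (star A (defectMap P y)) = star S y - star P (S y) := by
  refine ext_inner_right ℂ fun x => ?_
  rw [inner_defectMap, ContinuousLinearMap.star_eq_adjoint A,
    ContinuousLinearMap.adjoint_inner_left, ← inner_conj_symm, ← inner_defectMap, hA.apply,
    inner_conj_symm, inner_sub_right, inner_sub_left]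
  simp only [ContinuousLinearMap.star_eq_adjoint, ContinuousLinearMap.adjoint_inner_left,
    ContinuousLinearMap.adjoint_inner_right]

/-- `D_P` is injective on `𝒟_P`, and applying it to the right side gives `(S - S* P) + (S* P - P* S
P)`, applied to `x`, which is `D_P² S x`. This identity is what makes `T_A` commute with `V₀`. -/
lemma IsFundamentalOperator.defectMap_apply {S P : H →L[ℂ] H} (hc : Commute S P) (hP : ‖P‖ ≤ 1)
    {A : defectSpace P →L[ℂ] defectSpace P} (hA : IsFundamentalOperator S P A) (x : H) :
    defectMap P (S x) = A (defectMap P x) + star A (defectMap P (P x)) := by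
  refine sub_eq_zero.1 (eq_zero_of_defectOp_eq_zero ?_)
  have h1 : defectOp P (defectMap P (S x)) = S x - star P (P (S x)) := by
    change (defectOp P * defectOp P) (S x) = _
    rw [defectOp_mul_self hP]; rfl
  have h2 : P (S x) = S (P x) := by
    rw [← mul_apply_eq_comp, ← hc.eq, mul_apply_eq_comp]
  rw [Submodule.coe_sub, Submodule.coe_add, map_sub, map_add, hA.apply, hA.star_apply, h1, h2]
  abel

end Defect

/-! ### The von Neumann inequality for the dilation -/

section Dilation

variable {H : Type*} [NormedAddCommGroup H] [InnerProductSpace ℂ H] [CompleteSpace H]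

lemma dilT_snd_eq (S P : H →L[ℂ] H) (A : defectSpace P →L[ℂ] defectSpace P) (x : dilSpace P) :
    (dilT S P A x).snd = headOp (star A (defectMap P x.fst)) + toepOp A x.snd := rfl

lemma dilV_snd_eq (P : H →L[ℂ] H) (x : dilSpace P) :
    (dilV P x).snd = headOp (defectMap P x.fst) + shiftOp x.snd := rfl

lemma commute_dilT_dilV {S P : H →L[ℂ] H} (hc : Commute S P) (hP : ‖P‖ ≤ 1)
    {A : defectSpace P →L[ℂ] defectSpace P} (hA : IsFundamentalOperator S P A) :
    Commute (dilT S P A) (dilV P) := by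
  refine ContinuousLinearMap.ext fun x => ?_
  change dilT S P A (dilV P x) = dilV P (dilT S P A x)
  refine dilSpace_ext ?_ fun n => ?_
  · rw [dilT_fst, dilV_fst, dilV_fst, dilT_fst, ← mul_apply_eq_comp, hc.eq, mul_apply_eq_comp]
  · rcases n with _ | _ | n
    · rw [dilT_snd_zero, dilV_snd_zero, dilV_snd_zero, dilV_fst, dilT_fst,
        hA.defectMap_apply hc hP, add_comm]
    · rw [dilT_snd_succ, dilV_snd_succ, dilV_snd_succ, dilV_snd_zero, dilT_snd_zero]
    · rw [dilT_snd_succ, dilV_snd_succ, dilV_snd_succ, dilV_snd_succ, dilT_snd_succ]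

lemma norm_dilV {P : H →L[ℂ] H} (hP : ‖P‖ ≤ 1) (x : dilSpace P) : ‖dilV P x‖ = ‖x‖ := by
  refine (pow_left_inj₀ (norm_nonneg _) (norm_nonneg _) two_ne_zero).1 ?_
  rw [WithLp.prod_norm_sq_eq_of_L2, WithLp.prod_norm_sq_eq_of_L2, dilV_fst, ell2_norm_sq,
    (ell2_summable (dilV P x).snd).tsum_eq_zero_add, dilV_snd_zero, norm_sq_defectMap hP,
    ell2_norm_sq]
  simp only [dilV_snd_succ]
  ring

lemma norm_dilV_pow {P : H →L[ℂ] H} (hP : ‖P‖ ≤ 1) (n : ℕ) (x : dilSpace P) :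
    ‖(dilV P ^ n) x‖ = ‖x‖ := by
  induction n with
  | zero => rfl
  | succ n ih => rw [pow_succ', mul_apply_eq_comp, norm_dilV hP, ih]

/-- `‖D_P Pⁿ x‖² = ‖Pⁿ x‖² - ‖Pⁿ⁺¹ x‖²` is a difference of consecutive terms of a convergent
sequence. -/
lemma tendsto_defectMap_pow {P : H →L[ℂ] H} (hP : ‖P‖ ≤ 1) (x : H) :
    Tendsto (fun n => defectMap P ((P ^ n) x)) atTop (𝓝 0) := by
  have hanti : Antitone fun n => ‖(P ^ n) x‖ ^ 2 := by
    refine antitone_nat_of_succ_le fun n => pow_le_pow_left₀ (norm_nonneg _) ?_ 2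
    rw [pow_succ', mul_apply_eq_comp]
    exact (P.le_opNorm _).trans (mul_le_of_le_one_left (norm_nonneg _) hP)
  have hlim := tendsto_atTop_ciInf hanti ⟨0, by rintro _ ⟨n, rfl⟩; positivity⟩
  have h0 := hlim.sub ((tendsto_add_atTop_iff_nat 1).2 hlim)
  rw [sub_self] at h0
  rw [tendsto_zero_iff_norm_tendsto_zero]
  have h1 : Tendsto (fun n => ‖defectMap P ((P ^ n) x)‖ ^ 2) atTop (𝓝 0) := by
    refine h0.congr fun n => ?_
    rw [norm_sq_defectMap hP, pow_succ' P n, mul_apply_eq_comp]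
  simpa using h1.sqrt

/-- Sequences in the dilation space whose tail and whose defects along powers of `P` vanish
asymptotically. -/
def AsympNull (P : H →L[ℂ] H) (u : ℕ → dilSpace P) : Prop :=
  (∀ m : ℕ, Tendsto (fun n => defectMap P ((P ^ m) (u n).fst)) atTop (𝓝 0)) ∧
    Tendsto (fun n => (u n).snd) atTop (𝓝 0)

/-- Since `D_P Pᵐ S = A D_P Pᵐ + A* D_P Pᵐ⁺¹`, the condition at `m` needs the one at `m + 1`; this
is why `AsympNull` asks for all powers. -/
lemma AsympNull.dilT {S P : H →L[ℂ] H} (hc : Commute S P) (hP : ‖P‖ ≤ 1)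
    {A : defectSpace P →L[ℂ] defectSpace P} (hA : IsFundamentalOperator S P A)
    {u : ℕ → dilSpace P} (hu : AsympNull P u) :
    AsympNull P fun n => SymBidisc.dilT S P A (u n) := by
  constructor
  · intro m
    have e : ∀ n, defectMap P ((P ^ m) (SymBidisc.dilT S P A (u n)).fst) =
        A (defectMap P ((P ^ m) (u n).fst)) +
          star A (defectMap P ((P ^ (m + 1)) (u n).fst)) := by
      intro n
      rw [dilT_fst, ← mul_apply_eq_comp, ← (hc.pow_right m).eq, mul_apply_eq_comp,
        hA.defectMap_apply hc hP, pow_succ', mul_apply_eq_comp]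
    simp only [e]
    have h1 := (A.continuous.tendsto 0).comp (hu.1 m)
    have h2 := ((star A).continuous.tendsto 0).comp (hu.1 (m + 1))
    rw [map_zero] at h1 h2
    simpa using h1.add h2
  · simp only [dilT_snd_eq]
    have h1 := ((headOp ∘L star A).continuous.tendsto 0).comp (hu.1 0)
    have h2 := ((toepOp A).continuous.tendsto 0).comp hu.2
    rw [map_zero] at h1 h2
    simpa using h1.add h2

lemma AsympNull.dilV {P : H →L[ℂ] H} {u : ℕ → dilSpace P} (hu : AsympNull P u) :
    AsympNull P fun n => SymBidisc.dilV P (u n) := by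
  constructor
  · intro m
    refine (hu.1 (m + 1)).congr fun n => ?_
    rw [dilV_fst, pow_succ, mul_apply_eq_comp]
  · simp only [dilV_snd_eq]
    have h1 := (headOp.continuous.tendsto (0 : defectSpace P)).comp (hu.1 0)
    have h2 := (shiftOp.continuous.tendsto (0 : ell2 (defectSpace P))).comp hu.2
    rw [map_zero] at h1 h2
    simpa using h1.add h2

lemma AsympNull.polyOp {S P : H →L[ℂ] H} (hc : Commute S P) (hP : ‖P‖ ≤ 1)
    {A : defectSpace P →L[ℂ] defectSpace P} (hA : IsFundamentalOperator S P A)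
    (p : MvPolynomial (Fin 2) ℂ) : ∀ {u : ℕ → dilSpace P}, AsympNull P u →
    AsympNull P fun n => SymBidisc.polyOp p (SymBidisc.dilT S P A) (SymBidisc.dilV P) (u n) := by
  obtain ⟨φ, hφ, hφ0, hφ1⟩ := exists_polyOp_algHom (commute_dilT_dilV hc hP hA)
  simp only [← hφ]
  induction p using MvPolynomial.induction_on with
  | C a =>
    intro u hu
    rw [← MvPolynomial.algebraMap_eq, AlgHom.commutes, Algebra.algebraMap_eq_smul_one]
    constructor
    · intro m
      have := (hu.1 m).const_smul a
      rw [smul_zero] at this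
      refine this.congr fun n => ?_
      change a • defectMap P ((P ^ m) (u n).fst) = defectMap P ((P ^ m) (a • (u n).fst))
      rw [map_smul, map_smul]
    · have := hu.2.const_smul a
      rw [smul_zero] at this
      exact this
  | add p q hp hq =>
    intro u hu
    obtain ⟨h1, h2⟩ := hp hu
    obtain ⟨h3, h4⟩ := hq hu
    rw [map_add]
    constructor
    · intro m
      have := (h1 m).add (h3 m)
      rw [add_zero] at this
      refine this.congr fun n => ?_
      change _ = defectMap P ((P ^ m) ((φ p (u n)).fst + (φ q (u n)).fst))
      rw [map_add, map_add]
    · have := h2.add h4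
      rw [add_zero] at this
      exact this
  | mul_X p i hp =>
    intro u hu
    rw [map_mul]
    fin_cases i
    · simp only [Fin.zero_eta, hφ0]
      exact hp (hu.dilT hc hP hA)
    · simp only [Fin.mk_one, hφ1]
      exact hp hu.dilV

lemma dilV_pow_fst (P : H →L[ℂ] H) (n : ℕ) (x : dilSpace P) :
    ((dilV P ^ n) x).fst = (P ^ n) x.fst := by
  induction n with
  | zero => rfl
  | succ n ih => rw [pow_succ', mul_apply_eq_comp, dilV_fst, ih, pow_succ', mul_apply_eq_comp]

/-- `V₀ⁿ` is isometric and commutes with `Q = p(T_A, V₀)`, so `‖Q x‖ = ‖Q V₀ⁿ x‖`. Write `V₀ⁿ x =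
(Pⁿ x₀, 0) + (0, t)`: the diagonal blocks are bounded by `M`, and the off-diagonal contribution `(Q
(h n)).snd` tends to `0`. -/
lemma isGammaContraction_dil {S P : H →L[ℂ] H} (hSP : IsGammaContraction S P)
    {A : defectSpace P →L[ℂ] defectSpace P} (hA : IsFundamentalOperator S P A)
    (hA1 : ‖A‖ ≤ 1) : IsGammaContraction (dilT S P A) (dilV P) := by
  have hP := hSP.norm_snd_le_one
  obtain ⟨hc, hle⟩ := isGammaContraction_iff.1 hSP
  have hcd := commute_dilT_dilV hc hP hA
  refine isGammaContraction_iff.2 ⟨hcd, fun p => ?_⟩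
  set M := sSup ((fun y => ‖evalPt p y‖) '' Gam)
  have hM0 : 0 ≤ M := (norm_nonneg _).trans (hle p)
  refine ContinuousLinearMap.opNorm_le_bound _ hM0 fun x => ?_
  set Q := polyOp p (dilT S P A) (dilV P) with hQ
  let h : ℕ → dilSpace P := fun n => WithLp.toLp 2 ((P ^ n) x.fst, 0)
  have hh : AsympNull P h := by
    refine ⟨fun m => ?_, tendsto_const_nhds⟩
    refine ((tendsto_add_atTop_iff_nat m).2 (tendsto_defectMap_pow hP x.fst)).congr fun n => ?_
    rw [add_comm, pow_add, mul_apply_eq_comp]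
    rfl
  have hlim := (hh.polyOp hc hP hA p).2.norm
  rw [norm_zero] at hlim
  have hbound : ∀ n, ‖Q x‖ ^ 2 ≤
      (M * ‖x‖) ^ 2 + 2 * (M * ‖x‖) * ‖(Q (h n)).snd‖ + ‖(Q (h n)).snd‖ ^ 2 := by
    intro n
    set t := ((dilV P ^ n) x).snd with ht
    have hdec : (dilV P ^ n) x = h n + tailEmb P t := by
      refine WithLp.ofLp_injective 2 (Prod.ext ?_ ?_)
      · change ((dilV P ^ n) x).fst = (P ^ n) x.fst + 0
        rw [dilV_pow_fst, add_zero]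
      · change t = 0 + t
        rw [zero_add]
    have hnx : ‖x‖ ^ 2 = ‖(P ^ n) x.fst‖ ^ 2 + ‖t‖ ^ 2 := by
      rw [← norm_dilV_pow hP n x, WithLp.prod_norm_sq_eq_of_L2, dilV_pow_fst]
    have hcomm : Commute (dilV P ^ n) Q := by
      obtain ⟨φ, hφ, -, hφ1⟩ := exists_polyOp_algHom hcd
      rw [hQ, ← hφ, ← hφ1, ← map_pow, commute_iff_eq, ← map_mul, mul_comm, map_mul]
    have hQx : ‖Q x‖ = ‖Q ((dilV P ^ n) x)‖ := by
      rw [← norm_dilV_pow hP n (Q x), ← mul_apply_eq_comp, hcomm.eq, mul_apply_eq_comp]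
    have hfst : (Q ((dilV P ^ n) x)).fst = polyOp p S P ((P ^ n) x.fst) := by
      rw [hQ, polyOp_dil_fst, dilV_pow_fst]
    have hsnd : (Q ((dilV P ^ n) x)).snd =
        (Q (h n)).snd + polyOp p (toepOp A) shiftOp t := by
      rw [hdec, map_add, hQ, ← tailEmb_polyOp]; rfl
    rw [hQx, WithLp.prod_norm_sq_eq_of_L2, hfst, hsnd]
    have b1 : ‖polyOp p S P ((P ^ n) x.fst)‖ ≤ M * ‖(P ^ n) x.fst‖ :=
      (ContinuousLinearMap.le_opNorm _ _).trans
        (mul_le_mul_of_nonneg_right (hle p) (norm_nonneg _))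
    have b2 := norm_polyOp_toep_apply_le hA1 p t
    have b3 : ‖t‖ ≤ ‖x‖ := le_of_sq_le_sq (by nlinarith [sq_nonneg ‖(P ^ n) x.fst‖])
      (norm_nonneg _)
    have b4 := norm_add_le (Q (h n)).snd (polyOp p (toepOp A) shiftOp t)
    set e := ‖(Q (h n)).snd‖
    have he : 0 ≤ e := norm_nonneg _
    calc ‖polyOp p S P ((P ^ n) x.fst)‖ ^ 2 +
          ‖(Q (h n)).snd + polyOp p (toepOp A) shiftOp t‖ ^ 2
        ≤ (M * ‖(P ^ n) x.fst‖) ^ 2 + (e + M * ‖t‖) ^ 2 := by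
          gcongr
          exact b4.trans (by gcongr)
      _ = M ^ 2 * (‖(P ^ n) x.fst‖ ^ 2 + ‖t‖ ^ 2) + 2 * (M * ‖t‖) * e + e ^ 2 := by ring
      _ ≤ M ^ 2 * (‖(P ^ n) x.fst‖ ^ 2 + ‖t‖ ^ 2) + 2 * (M * ‖x‖) * e + e ^ 2 := by gcongr
      _ = (M * ‖x‖) ^ 2 + 2 * (M * ‖x‖) * e + e ^ 2 := by rw [← hnx]; ring
  have hlim2 := (tendsto_const_nhds (x := (M * ‖x‖) ^ 2) (f := (atTop : Filter ℕ))).add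
    (hlim.const_mul (2 * (M * ‖x‖))) |>.add (hlim.pow 2)
  have hfin := ge_of_tendsto' hlim2 hbound
  refine le_of_sq_le_sq ?_ (mul_nonneg hM0 (norm_nonneg _))
  simpa using hfin

lemma IsGammaDistinguished.dilation {S P : H →L[ℂ] H}
    {A : defectSpace P →L[ℂ] defectSpace P} (hSP : IsGammaDistinguished S P)
    (hA : IsFundamentalOperator S P A) (hyp : IsHyponormal A) (h : IsGammaDistinguished A 0) :
    IsGammaDistinguished (dilT S P A) (dilV P) := by
  obtain ⟨hAc, q₂, hq₂, hq₂0⟩ := h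
  obtain ⟨hSPc, q₁, hq₁, hq₁0⟩ := hSP
  have hf0 : Polynomial.aeval A (substSnd 0 q₂) = 0 := by
    rw [← polyOp_smul_one, zero_smul, hq₂0]
  have hev : ∀ l : ℂ, ‖l‖ = 1 → (substSnd 0 q₂).eval l ≠ 0 := fun l hl => by
    rw [eval_substSnd]; exact hq₂.eval_ne_zero hl
  have hne : substSnd 0 q₂ ≠ 0 := fun h0 => hev 1 norm_one (by rw [h0, Polynomial.eval_zero])
  have hn : IsStarNormal A := hyp.isStarNormal_of_aeval_eq_zero hne hf0
  have hA1 : ‖A‖ ≤ 1 := norm_le_one_of_isStarNormal hAc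
  obtain ⟨s, hs, hs0⟩ := exists_rootPoly_eq_zero hA1 hne hev hf0
  have hdil := isGammaContraction_dil hSPc hA hA1
  -- First `q₁` kills the `H` component and leaves a vector of the tail, where the pair is Toeplitz;
  -- then `linPolyProd s` kills the tail.
  refine ⟨hdil, linPolyProd s * q₁, hq₁.linPolyProd_mul s hs, ContinuousLinearMap.ext fun x => ?_⟩
  rw [polyOp_mul hdil.1, mul_apply_eq_comp]
  set y := polyOp q₁ (dilT S P A) (dilV P) x with hy
  have hyt : y = tailEmb P y.snd := by
    refine WithLp.ofLp_injective 2 (Prod.ext ?_ rfl)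
    change y.fst = 0
    rw [hy, polyOp_dil_fst, hq₁0]; rfl
  rw [hyt, ← tailEmb_polyOp, polyOp_linPolyProd_toep A hs0, zero_apply, map_zero, zero_apply]

end Dilation

end SymBidisc

end

theorem theorem9p12 {H : Type*} [NormedAddCommGroup H] [InnerProductSpace ℂ H] [CompleteSpace H]
    (S P : H →L[ℂ] H)
    (A : SymBidisc.defectSpace P →L[ℂ] SymBidisc.defectSpace P)
    (hSP : SymBidisc.IsGammaDistinguished S P)
    (hA : SymBidisc.IsFundamentalOperator S P A)
    (hyp : SymBidisc.IsHyponormal A) :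
    SymBidisc.IsGammaDistinguished (SymBidisc.dilT S P A) (SymBidisc.dilV P) ↔
      SymBidisc.IsGammaDistinguished A 0 :=
  ⟨fun h => h.of_dilation, fun h => hSP.dilation hA hyp h⟩
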